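/- All Lie algebras are over $\mathbb{C}$. Let $n\ge 1$, and let $a=(a_1,\dots,a_m)$ and $b=(b_1,\dots,b_t)$ be (possibly empty) sequences of positive integers with $\sum a_i\le n$ and $\sum b_i\le n$. **Seaweed.** Let $\hat a=(a_1,\dots,a_m,\,2(n-\sum a_i),\,a_m,\dots,a_1)$, and define $\hat b$ likewise. Cut $\{1,\dots,2n\}$ into consecutive blocks of sizes $\hat a$ (the $\hat a$-blocks), respectively $\hat b$ (the $\hat b$-blocks). A location $(i,j)$ is admissible if $i\ge j$ and $i,j$ lie in the same $\hat a$-block, or $i\le j$ and $i,j$ lie in the same $\hat b$-block. Let $\mathfrak{sp}(2n)$ be the Lie algebra of complex $2n\times 2n$ matrices $X$ with $X_{i,j}=-\varepsilon_i\varepsilon_j X_{2n-j+1,2n-i+1}$ for all $i,j$, where $\varepsilon_i=1$ for $i\le n$ and $\varepsilon_i=-1$ for $i>n$. The type-C seaweed $\mathfrak g=\mathfrak p_{2n}^C\frac{a_1|\dots|a_m}{b_1|\dots|b_t}$ is the Lie algebra of those $X\in\mathfrak{sp}(2n)$ whose entries vanish outside the admissible locations. Write $e_{i,j}$ for the matrix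 units and $e_{i,j}^*$ for the functional $X\mapsto X_{i,j}$ on $\mathfrak g$. **Meanders.** The meander $M_n^C(\mathfrak g)$ has vertices $v_1,\dots,v_n$. Cut the vertices into consecutive top blocks of sizes $a_1,\dots,a_m$ and consecutive bottom blocks of sizes $b_1,\dots,b_t$ (some vertices may be left over); in each block, join any two distinct vertices that are mirror images of each other in the block by an arc, drawn above for top blocks and below for bottom blocks. Every component is a path (possibly a single vertex) or a cycle. The tail is the set of all $v_i$ for which exactly one of $\sum a_j<i$ and $\sum b_j<i$ holds. The oriented full meander is built in the same way on $v_1,\dots,v_{2n}$ from $\hat a$ (top) and $\hat b$ (bottom), with top arcs directed from right to left and bottom arcs from left to right. **Homotopy type.** Starting from $\frac{a_1|\dots|a_m}{b_1|\dots|b_t}$ on $n$ vertices, apply the following moves as long as both sequences are non-empty: * if $a_1>2b_1$, pass to $\frac{a_1-2b_1|b_1|a_2|\dots|a_m}{b_2|\dots|b_t}$; * if $a_1=2b_1$, pass to $\frac{b_1|a_2|\dots|a_m}{b_2|\dots|b_t}$; * if $b_1<a_1<2b_1$, pass to $\frac{b_1|a_2|\dots|a_m}{2b_1-a_1|b_2|\dots|b_t}$;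 * if $a_1=b_1=c$, pass to $\frac{a_2|\dots|a_m}{b_2|\dots|b_t}$ (component deletion of size $c$); * if $a_1<b_1$, exchange the two sequences. The number of vertices drops by $b_1$, $b_1$, $a_1-b_1$, $c$ and $0$, respectively. Suppose that the component deletions have sizes $c_1,\dots,c_q$, and that the process ends on $k$ vertices with one sequence empty and the other equal to $(d_1,\dots,d_s)$. The homotopy type of $\mathfrak g$ is then $\mathcal H_C(c_1,\dots,c_q;\,d_1,\dots,d_s;\,2(k-\sum d_i))$, where a last entry $0$ is omitted. **Theorem.** Suppose that $\mathfrak g$ has homotopy type $\mathcal H_C(1;\,1,\dots,1)$; that is, there is exactly one component deletion and it has size $1$, $d_1=\dots=d_s=1$ for some $s\ge 0$, and $k=s$. Then there is a unique path $P$ in $M_n^C(\mathfrak g)$ with no endpoint in the tail. Let $V(P)$ be its vertex set, put $$\varphi_{(1)}=\sum_{v_i\in V(P)}e_{i,i}^*+\sum_{(v_i,v_j)}e_{i,j}^*\in\mathfrak g^*,$$ where the second sum is over all edges $(v_i,v_j)$ of the oriented full meander with $i\le n$ or $j\le n$, and let $B_{\varphi_{(1)}}(x,y)=\varphi_{(1)}([x,y])$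 for $x,y\in\mathfrak g$. Then $$\ker(B_{\varphi_{(1)}})=\operatorname{span}\Big\{\sum_{v_i\in V(P)}\left(e_{i,i}-e_{2n-i+1,2n-i+1}\right)\Big\}.$$ -/

import Mathlib

/-! Type-C seaweed algebras and their meanders.

A (partial) composition is a list of positive integers.  Vertices and matrix indices are
numbered from `0`, so the vertex `v_i` of the text is number `i - 1`, and the index
`2n - i + 1` of the text is `Fin.rev` of the index `i`. -/

-- Matrices carry the commutator bracket.
attribute [local instance 100] LieRing.ofAssociativeRing

namespace SeaweedC

/-- `c` is a partial composition of `n`. -/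
def IsPartialComposition (n : ℕ) (c : List ℕ) : Prop :=
  (∀ x ∈ c, 0 < x) ∧ c.sum ≤ n

/-- `i` and `j` lie in a common block, when `0, 1, 2, …` is cut into consecutive blocks whose
sizes are the entries of the list. -/
def SameBlock : List ℕ → ℕ → ℕ → Prop
  | [], _, _ => False
  | d :: c, i, j => (i < d ∧ j < d) ∨ (d ≤ i ∧ d ≤ j ∧ SameBlock c (i - d) (j - d))

/-- `i` and `j` are joined by an arc: they are distinct, lie in a common block, and are mirror
images of each other in that block. -/
def Arc : List ℕ → ℕ → ℕ → Prop
  | [], _, _ => False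
  | d :: c, i, j =>
      (i < d ∧ j < d ∧ i ≠ j ∧ i + j + 1 = d) ∨ (d ≤ i ∧ d ≤ j ∧ Arc c (i - d) (j - d))

/-- The palindromic composition `c₁ | … | c_m | 2(n - ∑ c) | c_m | … | c₁` of `2n`
(the middle block may be empty). -/
def fullComposition (n : ℕ) (c : List ℕ) : List ℕ :=
  c ++ (2 * (n - c.sum)) :: c.reverse

/-! ### The seaweed algebra -/

/-- Admissible locations: lower triangular positions in the diagonal blocks given by `a`, and
upper triangular positions in the diagonal blocks given by `b`. -/
def Admissible (n : ℕ) (a b : List ℕ) (i j : Fin (2 * n)) : Prop :=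
  (j ≤ i ∧ SameBlock (fullComposition n a) i j) ∨ (i ≤ j ∧ SameBlock (fullComposition n b) i j)

/-- The antidiagonal matrix with entries `1` in the first `n` rows, `-1` in the last `n` rows. -/
def antidiagForm (n : ℕ) : Matrix (Fin (2 * n)) (Fin (2 * n)) ℂ :=
  Matrix.of fun i j => if j = i.rev then (if (i : ℕ) < n then 1 else -1) else 0

/-- `sp(2n)`, the matrices `X` with `Xᵀ J = - J X` for the antidiagonal form `J`. -/
noncomputable def sp (n : ℕ) : LieSubalgebra ℂ (Matrix (Fin (2 * n)) (Fin (2 * n)) ℂ) :=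
  skewAdjointMatricesLieSubalgebra (antidiagForm n)

/-- Entrywise: `X_{i,j} = ∓ X_{2n-j+1,2n-i+1}`, with `-` on the two diagonal `n × n` quarters and
`+` on the other two, as in the Chevalley basis. -/
theorem mem_sp (n : ℕ) (X : Matrix (Fin (2 * n)) (Fin (2 * n)) ℂ) :
    X ∈ sp n ↔ ∀ i j, X i j = -(if (i : ℕ) < n then 1 else -1) *
      (if (j : ℕ) < n then 1 else -1) * X j.rev i.rev := by
  have e1 : X ∈ sp n ↔ X.transpose * antidiagForm n = antidiagForm n * (-X) := by
    simp [sp, Matrix.IsSkewAdjoint, Matrix.IsAdjointPair]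
  rw [e1, ← Matrix.ext_iff]
  have l : ∀ i j, (X.transpose * antidiagForm n) i j = X j.rev i * (if (j : ℕ) < n then -1 else 1) := by
    intro i j
    rw [Matrix.mul_apply, Finset.sum_eq_single j.rev]
    · have := j.2
      by_cases h : (j : ℕ) < n
      · simp [antidiagForm, h, Fin.val_rev]; omega
      · simp [antidiagForm, h, Fin.val_rev]; omega
    · intro b _ hb
      have : j ≠ b.rev := fun h => hb (by simp [h])
      simp [antidiagForm, this]
    · simp
  have r : ∀ i j, (antidiagForm n * (-X)) i j = (if (i : ℕ) < n then 1 else -1) * (- X i.rev j) := by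
    intro i j
    rw [Matrix.mul_apply, Finset.sum_eq_single i.rev]
    · simp [antidiagForm]
    · intro b _ hb
      simp [antidiagForm, hb]
    · simp
  simp only [l, r]
  constructor
  · intro H i j
    have := H i.rev j
    simp only [Fin.rev_rev, Fin.val_rev] at this
    have hi := i.2
    have hc : (2 * n - ((i : ℕ)+1) < n) ↔ ¬ (i : ℕ) < n := by omega
    rw [if_congr hc rfl rfl] at this
    split_ifs at this ⊢ <;>
      first | linear_combination this | linear_combination -this
  · intro H i j
    have := H i.rev j
    simp only [Fin.rev_rev, Fin.val_rev] at this
    have hi := i.2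
    have hc : (2 * n - ((i : ℕ)+1) < n) ↔ ¬ (i : ℕ) < n := by omega
    rw [if_congr hc rfl rfl] at this
    split_ifs at this ⊢ <;>
      first | linear_combination this | linear_combination -this

theorem SameBlock.trans {c : List ℕ} {i j k : ℕ} (h₁ : SameBlock c i j) (h₂ : SameBlock c j k) :
    SameBlock c i k := by
  induction c generalizing i j k with
  | nil => exact h₁
  | cons d c ih =>
    rcases h₁ with h₁ | h₁ <;> rcases h₂ with h₂ | h₂
    · exact Or.inl ⟨h₁.1, h₂.2⟩
    · omega
    · omega
    · exact Or.inr ⟨h₁.1, h₂.2.1, ih h₁.2.2 h₂.2.2⟩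

theorem SameBlock.symm {c : List ℕ} {i j : ℕ} (h : SameBlock c i j) : SameBlock c j i := by
  induction c generalizing i j with
  | nil => exact h
  | cons d c ih =>
    rcases h with h | h
    · exact Or.inl ⟨h.2, h.1⟩
    · exact Or.inr ⟨h.2.1, h.1, ih h.2.2⟩

theorem SameBlock.between {c : List ℕ} {i j k : ℕ} (h : SameBlock c i k) (hij : i ≤ j)
    (hjk : j ≤ k) : SameBlock c i j := by
  induction c generalizing i j k with
  | nil => exact h
  | cons d c ih =>
    rcases h with h | h
    · exact Or.inl ⟨h.1, by omega⟩
    · exact Or.inr ⟨h.1, by omega, ih h.2.2 (by omega) (by omega)⟩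

theorem Admissible.trans {n : ℕ} {a b : List ℕ} {i k j : Fin (2 * n)}
    (h₁ : Admissible n a b i k) (h₂ : Admissible n a b k j) : Admissible n a b i j := by
  rcases h₁ with ⟨l₁, s₁⟩ | ⟨l₁, s₁⟩ <;> rcases h₂ with ⟨l₂, s₂⟩ | ⟨l₂, s₂⟩
  · exact Or.inl ⟨l₂.trans l₁, s₁.trans s₂⟩
  · rcases le_total j i with h | h
    · exact Or.inl ⟨h, s₁.trans (s₁.symm.between l₂ h)⟩
    · exact Or.inr ⟨h, (s₂.between l₁ h).symm.trans s₂⟩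
  · rcases le_total j i with h | h
    · exact Or.inl ⟨h, (s₂.symm.between h l₁).symm⟩
    · exact Or.inr ⟨h, s₁.between h l₂⟩
  · exact Or.inr ⟨l₁.trans l₂, s₁.trans s₂⟩

/-- The matrices supported on the admissible locations. -/
def supportedMatrices (n : ℕ) (a b : List ℕ) :
    LieSubalgebra ℂ (Matrix (Fin (2 * n)) (Fin (2 * n)) ℂ) where
  carrier := {X | ∀ i j, ¬ Admissible n a b i j → X i j = 0}
  zero_mem' := fun _ _ _ => rfl
  add_mem' := fun hX hY i j h => by simp [hX i j h, hY i j h]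
  smul_mem' := fun c X hX i j h => by simp [hX i j h]
  lie_mem' := by
    intro X Y hX hY i j h
    have key : ∀ U V : Matrix (Fin (2 * n)) (Fin (2 * n)) ℂ,
        (∀ i j, ¬ Admissible n a b i j → U i j = 0) →
        (∀ i j, ¬ Admissible n a b i j → V i j = 0) → (U * V) i j = 0 := by
      intro U V hU hV
      rw [Matrix.mul_apply]
      refine Finset.sum_eq_zero fun k _ => ?_
      by_cases h₁ : Admissible n a b i k
      · have h₂ : ¬ Admissible n a b k j := fun h₂ => h (h₁.trans h₂)
        rw [hV k j h₂, mul_zero]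
      · rw [hU i k h₁, zero_mul]
    rw [Ring.lie_def, Matrix.sub_apply, key X Y hX hY, key Y X hY hX, sub_zero]

/-- The type-C seaweed `𝔭_{2n}^C (a / b)`. -/
noncomputable def seaweed (n : ℕ) (a b : List ℕ) :
    LieSubalgebra ℂ (Matrix (Fin (2 * n)) (Fin (2 * n)) ℂ) :=
  sp n ⊓ supportedMatrices n a b

/-- The Kirillov form `B_φ(x, y) = φ([x, y])`. -/
noncomputable def kirillovForm {L : Type*} [LieRing L] [LieAlgebra ℂ L]
    (φ : Module.Dual ℂ L) : LinearMap.BilinForm ℂ L :=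
  LinearMap.mk₂ ℂ (fun x y => φ ⁅x, y⁆)
    (fun x y z => by simp) (fun c x y => by simp) (fun x y z => by simp) (fun c x y => by simp)

/-! ### Meanders -/

theorem Arc.symm {c : List ℕ} {i j : ℕ} (h : Arc c i j) : Arc c j i := by
  induction c generalizing i j with
  | nil => exact h
  | cons d c ih =>
    rcases h with h | h
    · exact Or.inl ⟨h.2.1, h.1, h.2.2.1.symm, by omega⟩
    · exact Or.inr ⟨h.2.1, h.1, ih h.2.2⟩

theorem Arc.ne {c : List ℕ} {i j : ℕ} (h : Arc c i j) : i ≠ j := by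
  induction c generalizing i j with
  | nil => exact h.elim
  | cons d c ih =>
    rcases h with h | h
    · exact h.2.2.1
    · have := ih h.2.2
      omega

/-- The meander on the `n` vertices `v_1, …, v_n`: top arcs from `a`, bottom arcs from `b`. -/
def meander (n : ℕ) (a b : List ℕ) : SimpleGraph (Fin n) where
  Adj i j := Arc a i j ∨ Arc b i j
  symm := ⟨fun _ _ h => h.imp Arc.symm Arc.symm⟩
  loopless := ⟨fun _ h => h.elim (fun h => h.ne rfl) (fun h => h.ne rfl)⟩

/-- The vertices incident with at most one arc, that is, not with both a top and a bottom arc.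
Every component of a meander is a path or a cycle; its vertices of this kind are the endpoints
(an isolated vertex is a path, a doubled arc is a cycle). -/
def IsEndpoint (a b : List ℕ) (i : ℕ) : Prop :=
  ¬ ((∃ j, Arc a i j) ∧ (∃ j, Arc b i j))

/-- The tail: the vertices that lie beyond exactly one of the two partial compositions. -/
def InTail (a b : List ℕ) (i : ℕ) : Prop :=
  Xor (a.sum ≤ i) (b.sum ≤ i)

/-- `P` is a path of the meander (a component with an endpoint, hence not a cycle) none of whose
endpoints is in the tail. -/
def IsTailFreePath (n : ℕ) (a b : List ℕ) (P : (meander n a b).ConnectedComponent) : Prop :=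
  (∃ i ∈ P.supp, IsEndpoint a b i) ∧ ∀ i ∈ P.supp, IsEndpoint a b i → ¬ InTail a b i

/-- Directed edges of the oriented full meander on `2n` vertices, oriented counterclockwise:
top arcs from right to left, bottom arcs from left to right. -/
def OrientedFullEdge (n : ℕ) (a b : List ℕ) (i j : Fin (2 * n)) : Prop :=
  (j < i ∧ Arc (fullComposition n a) i j) ∨ (i < j ∧ Arc (fullComposition n b) i j)

/-! ### Winding down and the homotopy type -/

/-- `WindsDown n a b cs k r`: the winding-down moves, starting from the meander on `n` vertices of
fractional form `a / b`, perform component deletions of sizes `cs` (in this order) and end in a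
meander on `k` vertices, one of whose partial compositions is empty and the other one is `r`. -/
inductive WindsDown : ℕ → List ℕ → List ℕ → List ℕ → ℕ → List ℕ → Prop
  | done_bottom (n : ℕ) (a : List ℕ) : WindsDown n a [] [] n a
  | done_top (n : ℕ) (b : List ℕ) : WindsDown n [] b [] n b
  | pure_contraction (n x y : ℕ) (a b cs : List ℕ) (k : ℕ) (r : List ℕ) (h : 2 * y < x)
      (w : WindsDown (n - y) ((x - 2 * y) :: y :: a) b cs k r) :
      WindsDown n (x :: a) (y :: b) cs k r
  | block_elimination (n x y : ℕ) (a b cs : List ℕ) (k : ℕ) (r : List ℕ) (h : x = 2 * y)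
      (w : WindsDown (n - y) (y :: a) b cs k r) :
      WindsDown n (x :: a) (y :: b) cs k r
  | rotation_contraction (n x y : ℕ) (a b cs : List ℕ) (k : ℕ) (r : List ℕ)
      (h₁ : y < x) (h₂ : x < 2 * y)
      (w : WindsDown (n - (x - y)) (y :: a) ((2 * y - x) :: b) cs k r) :
      WindsDown n (x :: a) (y :: b) cs k r
  | component_deletion (n c : ℕ) (a b cs : List ℕ) (k : ℕ) (r : List ℕ)
      (w : WindsDown (n - c) a b cs k r) :
      WindsDown n (c :: a) (c :: b) (c :: cs) k r
  | flip (n x y : ℕ) (a b cs : List ℕ) (k : ℕ) (r : List ℕ) (h : x < y)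
      (w : WindsDown n (y :: b) (x :: a) cs k r) :
      WindsDown n (x :: a) (y :: b) cs k r

/-- The seaweed `𝔭_{2n}^C (a / b)` has homotopy type `H_C(cs, tails, aftertail)`, where `cs` are
the deleted components, `tails` the tail components, and `aftertail` is twice the number of
aftertail vertices (`0` stands for an absent aftertail component). -/
def HasHomotopyType (n : ℕ) (a b cs tails : List ℕ) (aftertail : ℕ) : Prop :=
  ∃ k, WindsDown n a b cs k tails ∧ aftertail = 2 * (k - tails.sum)

/-! ### The one-form and the generator of the kernel -/

/-- The vertex `v_i` of the meander, as an index of the `2n × 2n` matrices. -/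
def lift {n : ℕ} (i : Fin n) : Fin (2 * n) :=
  Fin.castLE (by omega) i

/-- The coordinate functional `e_{i,j}^*`. For an admissible location with `i + j ≤ 2n + 1` (in
numbering from `1`) it is the dual vector to the Chevalley basis vector of that location. -/
noncomputable def coord (n : ℕ) (a b : List ℕ) (i j : Fin (2 * n)) :
    Module.Dual ℂ (seaweed n a b) where
  toFun X := (X : Matrix (Fin (2 * n)) (Fin (2 * n)) ℂ) i j
  map_add' _ _ := rfl
  map_smul' _ _ := rfl

open Classical in
/-- The one-form `φ_(1)`, for the vertex set `V` of the path: the sum of the `e_{i,i}^*` over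
`v_i ∈ V` and of the `e_{i,j}^*` over all edges `(v_i, v_j)` of the oriented full meander with
`i ≤ n` or `j ≤ n` (in numbering from `1`). -/
noncomputable def phiOne (n : ℕ) (a b : List ℕ) (V : Set (Fin n)) :
    Module.Dual ℂ (seaweed n a b) :=
  ∑ i : Fin n with i ∈ V, coord n a b (lift i) (lift i) +
    ∑ p : Fin (2 * n) × Fin (2 * n) with
      OrientedFullEdge n a b p.1 p.2 ∧ ((p.1 : ℕ) < n ∨ (p.2 : ℕ) < n),
      coord n a b p.1 p.2

open Classical in
/-- `∑_{v_i ∈ V} (e_{i,i} - e_{2n-i+1,2n-i+1})`. -/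
noncomputable def hOne (n : ℕ) (V : Set (Fin n)) : Matrix (Fin (2 * n)) (Fin (2 * n)) ℂ :=
  ∑ i : Fin n with i ∈ V,
    (Matrix.single (lift i) (lift i) 1 - Matrix.single (lift i).rev (lift i).rev 1)

end SeaweedC

namespace SeaweedC

/-! Through the trace form, twice the functional `phiOne` is represented by a matrix F = `phiMatrix`
in sp(2n) whose off-diagonal support is, up to transposition, the set of edges of the oriented full
meander. If X lies in the kernel, then [F, X] is again in sp(2n), and pairing it with the elements
`spRoot i j` shows that its entry (j, i) vanishes for every admissible (i, j). So X also lies in the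
kernel of the form given by Y ↦ tr(FY) on the larger type-A seaweed of â and b̂.

The core is `KernelData.isDiagonalAlong`: if the meander has no cycle, an element of the type-A
kernel is diagonal and constant along the arcs. The proof winds the meander down. Let x > y be the
sizes of the first top and bottom block. Then X is block triangular for the cut at y. The first y
vertices are reflected in the top block onto its last y vertices, conjugated by the coefficients of
the arcs used, and overlaid on the rest. The result is a kernel element for the wound-down meander,
because the defects of the two partial commutators cancel (`FoldData.fold_comm`), and its
diagonality passes back to X (`FoldData.diagonal_of_fold`).

Absence of cycles is encoded by an integer grading that rises by 2 along every directed arc. Each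
arc is a counterclockwise half turn, and a simple closed curve has nonzero total turning, so a cycle
admits no grading. In the induction it forces equal first blocks to have size 1.

The homotopy type enters through `WindsDown.meanderData`. Undoing the moves yields a grading with
values ±1 on the tail, which therefore extends oddly to the full meander, and a single vertex i₀
whose value determines any function that is constant along arcs and zero on the tail. The diagonal
of an element of sp(2n) is odd under reflection, while the middle blocks join each tail vertex to
its reflection. So a kernel element vanishes on the tail and is a multiple of the indicator of the
one tail-free path, extended oddly. -/

/-- Directed arcs: top arcs go from right to left, bottom arcs from left to right. -/
def DirectedArc (a b : List ℕ) (i j : ℕ) : Prop :=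
  (j < i ∧ Arc a i j) ∨ (i < j ∧ Arc b i j)

/-- Admissible locations of the type-A seaweed of `a` and `b`. -/
def AdmissibleA (a b : List ℕ) (i j : ℕ) : Prop :=
  (j ≤ i ∧ SameBlock a i j) ∨ (i ≤ j ∧ SameBlock b i j)

theorem arc_zero_cons (c : List ℕ) : Arc (0 :: c) = Arc c := by
  ext i j; simp [Arc]

theorem sameBlock_zero_cons (c : List ℕ) : SameBlock (0 :: c) = SameBlock c := by
  ext i j; simp [SameBlock]

theorem SameBlock.lt_sum {c : List ℕ} {i j : ℕ} (h : SameBlock c i j) : i < c.sum := by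
  induction c generalizing i j with
  | nil => exact h.elim
  | cons d c ih =>
    rw [List.sum_cons]
    rcases h with h | h
    · omega
    · have := ih h.2.2
      omega

theorem Arc.sameBlock {c : List ℕ} {i j : ℕ} (h : Arc c i j) : SameBlock c i j := by
  induction c generalizing i j with
  | nil => exact h
  | cons d c ih =>
    rcases h with h | h
    · exact Or.inl ⟨h.1, h.2.1⟩
    · exact Or.inr ⟨h.1, h.2.1, ih h.2.2⟩

theorem Arc.lt_sum {c : List ℕ} {i j : ℕ} (h : Arc c i j) : i < c.sum :=
  h.sameBlock.lt_sum

/-! ### Blocks and arcs under a winding-down move -/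

/-- The locations of the top blocks after winding down, in the numbering of the old vertices. -/
theorem sameBlock_top_move {x y p q m : ℕ} {a : List ℕ} (hyx : y < x) (hm : m = min y (x - y))
    (hp : m ≤ p) (hq : m ≤ q) :
    SameBlock ((x - 2 * y) :: y :: a) (p - m) (q - m) ↔
      (p < x - y ∧ q < x - y) ∨ (x - y ≤ p ∧ p < x ∧ x - y ≤ q ∧ q < x) ∨
        (x ≤ p ∧ x ≤ q ∧ SameBlock a (p - x) (q - x)) := by
  simp only [SameBlock]
  by_cases h : x ≤ p ∧ x ≤ q
  · rw [show p - m - (x - 2 * y) - y = p - x by omega,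
      show q - m - (x - 2 * y) - y = q - x by omega]
    generalize SameBlock a (p - x) (q - x) = R
    by_cases hR : R <;> simp only [hR, and_true, and_false, or_false] <;>
      rcases le_total x (2 * y) with h2 | h2 <;> constructor <;> intros <;> omega
  · generalize SameBlock a _ _ = R
    generalize SameBlock a _ _ = R'
    by_cases hR : R <;> by_cases hR' : R' <;>
      simp only [hR, hR', and_true, and_false, or_false] <;>
      rcases le_total x (2 * y) with h2 | h2 <;> constructor <;> intros <;> omega

theorem sameBlock_bottom_move {x y p q m : ℕ} {b : List ℕ} (hyx : y < x) (hm : m = min y (x - y))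
    (hp : m ≤ p) (hq : m ≤ q) :
    SameBlock ((2 * y - x) :: b) (p - m) (q - m) ↔
      (p < y ∧ q < y) ∨ (y ≤ p ∧ y ≤ q ∧ SameBlock b (p - y) (q - y)) := by
  simp only [SameBlock]
  by_cases h : y ≤ p ∧ y ≤ q
  · rw [show p - m - (2 * y - x) = p - y by omega, show q - m - (2 * y - x) = q - y by omega]
    generalize SameBlock b (p - y) (q - y) = R
    by_cases hR : R <;> simp only [hR, and_true, and_false, or_false] <;>
      rcases le_total x (2 * y) with h2 | h2 <;> constructor <;> intros <;> omega
  · generalize SameBlock b _ _ = R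
    generalize SameBlock b _ _ = R'
    by_cases hR : R <;> by_cases hR' : R' <;>
      simp only [hR, hR', and_true, and_false, or_false] <;>
      rcases le_total x (2 * y) with h2 | h2 <;> constructor <;> intros <;> omega

theorem arc_top_move {x y p q m : ℕ} {a : List ℕ} (hyx : y < x) (hm : m = min y (x - y))
    (hp : m ≤ p) (hq : m ≤ q) :
    Arc ((x - 2 * y) :: y :: a) (p - m) (q - m) ↔
      p ≠ q ∧ ((p < x - y ∧ q < x - y ∧ p + q + 1 = x) ∨
        (x - y ≤ p ∧ p < x ∧ x - y ≤ q ∧ q < x ∧ p + q + 1 + y = 2 * x)) ∨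
        (x ≤ p ∧ x ≤ q ∧ Arc a (p - x) (q - x)) := by
  obtain ⟨P, rfl⟩ := Nat.exists_eq_add_of_le' hp
  obtain ⟨Q, rfl⟩ := Nat.exists_eq_add_of_le' hq
  simp only [add_tsub_cancel_right, Arc]
  -- Writing x - y = z + m removes the truncated differences: either m = y, or z = 0 and m = x - y.
  have key : ∀ z, x = z + m + y → x - 2 * y = z → (z = 0 ∨ m = y) →
      ((P < z ∧ Q < z ∧ P ≠ Q ∧ P + Q + 1 = z ∨
        z ≤ P ∧ z ≤ Q ∧ (P - z < y ∧ Q - z < y ∧ P - z ≠ Q - z ∧ P - z + (Q - z) + 1 = y ∨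
          y ≤ P - z ∧ y ≤ Q - z ∧ Arc a (P - z - y) (Q - z - y))) ↔
      P + m ≠ Q + m ∧ ((P + m < x - y ∧ Q + m < x - y ∧ P + m + (Q + m) + 1 = x) ∨
        (x - y ≤ P + m ∧ P + m < x ∧ x - y ≤ Q + m ∧ Q + m < x ∧
          P + m + (Q + m) + 1 + y = 2 * x)) ∨
        (x ≤ P + m ∧ x ≤ Q + m ∧ Arc a (P + m - x) (Q + m - x))) := by
    intro z hz _ hz0
    rw [show x - y = z + m by omega]
    subst hz
    rw [show P + m - (z + m + y) = P - z - y by omega,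
      show Q + m - (z + m + y) = Q - z - y by omega]
    constructor
    · rintro (⟨h1, h2, h3, h4⟩ | ⟨h1, h2, ⟨h3, h4, h5, h6⟩ | ⟨h3, h4, h5⟩⟩)
      · refine Or.inl ⟨by omega, Or.inl ⟨by omega, by omega, by omega⟩⟩
      · refine Or.inl ⟨by omega, Or.inr ⟨by omega, by omega, by omega, by omega, by omega⟩⟩
      · exact Or.inr ⟨by omega, by omega, h5⟩
    · rintro (⟨h1, ⟨h2, h3, h4⟩ | ⟨h2, h3, h4, h5, h6⟩⟩ | ⟨h1, h2, h3⟩)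
      · exact Or.inl ⟨by omega, by omega, by omega, by omega⟩
      · exact Or.inr ⟨by omega, by omega, Or.inl ⟨by omega, by omega, by omega, by omega⟩⟩
      · exact Or.inr ⟨by omega, by omega, Or.inr ⟨by omega, by omega, h3⟩⟩
  exact key _ (by omega) rfl (by omega)

theorem arc_bottom_move {x y p q m : ℕ} {b : List ℕ} (hyx : y < x) (hm : m = min y (x - y))
    (hp : m ≤ p) (hq : m ≤ q) :
    Arc ((2 * y - x) :: b) (p - m) (q - m) ↔
      (p ≠ q ∧ p < y ∧ q < y ∧ p + q + 1 = x) ∨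
        (y ≤ p ∧ y ≤ q ∧ Arc b (p - y) (q - y)) := by
  simp only [Arc]
  by_cases h : y ≤ p ∧ y ≤ q
  · rw [show p - m - (2 * y - x) = p - y by omega, show q - m - (2 * y - x) = q - y by omega]
    generalize Arc b (p - y) (q - y) = R
    by_cases hR : R <;> simp only [hR, and_true, and_false, or_false] <;>
      rcases le_total x (2 * y) with h2 | h2 <;> constructor <;> intros <;> omega
  · generalize Arc b _ _ = R
    generalize Arc b _ _ = R'
    by_cases hR : R <;> by_cases hR' : R' <;>
      simp only [hR, hR', and_true, and_false, or_false] <;>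
      rcases le_total x (2 * y) with h2 | h2 <;> constructor <;> intros <;> omega

theorem DirectedArc.swap {a b : List ℕ} {i j : ℕ} (h : DirectedArc a b i j) :
    DirectedArc b a j i :=
  h.elim (fun h => Or.inr ⟨h.1, h.2.symm⟩) (fun h => Or.inl ⟨h.1, h.2.symm⟩)

/-! ### Gradings and their behaviour under winding down -/

/-- A function on the vertices that increases by `d` along every directed arc. -/
def IsGraded {R : Type*} [AddCommGroup R] (d : R) (a b : List ℕ) (f : ℕ → R) : Prop :=
  ∀ i j, DirectedArc a b i j → f j = f i + d

theorem IsGraded.swap {R : Type*} [AddCommGroup R] {d : R} {a b : List ℕ} {f : ℕ → R}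
    (h : IsGraded d a b f) : IsGraded d b a (fun i => -f i) := by
  intro i j hij
  have := h j i hij.swap
  simp only
  rw [this]
  abel

section Move

variable {R : Type*} [AddCommGroup R] {d : R} {x y m : ℕ} {a b : List ℕ}

/-- At least one of the truncated differences x - 2y and 2y - x is zero, so this single form covers
pure contraction, block elimination and rotation contraction. The first m vertices are the ones
removed. -/
theorem directedArc_move (hyx : y < x) (hm : m = min y (x - y)) {p q : ℕ} (hp : m ≤ p)
    (hq : m ≤ q) :
    DirectedArc ((x - 2 * y) :: y :: a) ((2 * y - x) :: b) (p - m) (q - m) ↔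
      (q < p ∧ (p ≠ q ∧ ((p < x - y ∧ q < x - y ∧ p + q + 1 = x) ∨
        (x - y ≤ p ∧ p < x ∧ x - y ≤ q ∧ q < x ∧ p + q + 1 + y = 2 * x)) ∨
        (x ≤ p ∧ x ≤ q ∧ Arc a (p - x) (q - x)))) ∨
      (p < q ∧ ((p ≠ q ∧ p < y ∧ q < y ∧ p + q + 1 = x) ∨
        (y ≤ p ∧ y ≤ q ∧ Arc b (p - y) (q - y)))) := by
  rw [DirectedArc, arc_top_move hyx hm hp hq, arc_bottom_move hyx hm hp hq]
  have h₁ : q - m < p - m ↔ q < p := by omega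
  have h₂ : p - m < q - m ↔ p < q := by omega
  rw [h₁, h₂]

/-- A graded function stays graded when the meander is wound down. -/
theorem IsGraded.wind {f : ℕ → R} (hf : IsGraded d (x :: a) (y :: b) f) (hyx : y < x)
    (hm : m = min y (x - y)) :
    IsGraded d ((x - 2 * y) :: y :: a) ((2 * y - x) :: b)
      (fun i => if y ≤ i + m then f (i + m) else f (x - 1 - (i + m)) - d) := by
  intro i j h
  -- On the reflected block both branches agree: a vertex p ≥ y there is joined to its mirror image
  -- by a top arc, along which f rises by d.
  have gC : ∀ p, x - y ≤ p → p < x →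
      (if y ≤ p then f p else f (x - 1 - p) - d) = f (x - 1 - p) - d := by
    intro p hp hpx
    split_ifs with hpy
    · rw [hf p (x - 1 - p) (Or.inl ⟨by omega, Or.inl ⟨hpx, by omega, by omega, by omega⟩⟩)]
      abel
    · rfl
  rw [← Nat.add_sub_cancel (n := i) (m := m), ← Nat.add_sub_cancel (n := j) (m := m),
    directedArc_move hyx hm (by omega) (by omega)] at h
  simp only
  rcases h with ⟨h₀, ⟨h₁, h | h⟩ | h⟩ | ⟨h₀, h | h⟩
  · rw [if_pos (by omega), if_pos (by omega)]
    exact hf _ _ (Or.inl ⟨by omega, Or.inl ⟨by omega, by omega, h₁, by omega⟩⟩)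
  · rw [gC _ (by omega) (by omega), gC _ (by omega) (by omega),
      hf (x - 1 - (i + m)) (x - 1 - (j + m))
        (Or.inr ⟨by omega, Or.inl ⟨by omega, by omega, by omega, by omega⟩⟩)]
    abel
  · rw [if_pos (by omega), if_pos (by omega)]
    exact hf _ _ (Or.inl ⟨by omega, Or.inr h⟩)
  · rw [gC _ (by omega) (by omega), gC _ (by omega) (by omega),
      hf (x - 1 - (i + m)) (x - 1 - (j + m))
        (Or.inl ⟨by omega, Or.inl ⟨by omega, by omega, by omega, by omega⟩⟩)]
    abel
  · rw [if_pos (by omega), if_pos (by omega)]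
    exact hf _ _ (Or.inr ⟨by omega, Or.inr h⟩)

/-- A graded function on the wound down meander extends to a graded function. -/
theorem IsGraded.unwind {f : ℕ → R} (hf : IsGraded d ((x - 2 * y) :: y :: a) ((2 * y - x) :: b) f)
    (hyx : y < x) (hm : m = min y (x - y)) :
    IsGraded d (x :: a) (y :: b)
      (fun p => if y ≤ p then f (p - m) else f (x - 1 - p - m) + d) := by
  intro p q h
  simp only
  have hf' : ∀ p q, m ≤ p → m ≤ q → _ → f (q - m) = f (p - m) + d := fun p q hp hq h =>
    hf (p - m) (q - m) ((directedArc_move hyx hm hp hq).2 h)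
  rcases h with ⟨h₀, ⟨h₁, h₂, h₃, h₄⟩ | ⟨h₁, h₂, h₃⟩⟩ | ⟨h₀, ⟨h₁, h₂, h₃, h₄⟩ | ⟨h₁, h₂, h₃⟩⟩
  · by_cases hp : y ≤ p
    · rw [if_pos hp]
      by_cases hq : y ≤ q
      · rw [if_pos hq]
        exact hf' _ _ (by omega) (by omega) (Or.inl ⟨h₀, Or.inl ⟨h₃, Or.inl (by omega)⟩⟩)
      · rw [if_neg hq, show x - 1 - q = p by omega]
    · rw [if_neg hp, if_neg (by omega), hf' (x - 1 - p) (x - 1 - q) (by omega) (by omega)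
        (Or.inr ⟨by omega, Or.inl (by omega)⟩)]
  · rw [if_pos (by omega), if_pos (by omega)]
    exact hf' _ _ (by omega) (by omega) (Or.inl ⟨h₀, Or.inr ⟨h₁, h₂, h₃⟩⟩)
  · rw [if_neg (by omega), if_neg (by omega), hf' (x - 1 - p) (x - 1 - q) (by omega) (by omega)
        (Or.inl ⟨by omega, Or.inl ⟨by omega, Or.inr (by omega)⟩⟩)]
  · rw [if_pos (by omega), if_pos (by omega)]
    exact hf' _ _ (by omega) (by omega) (Or.inr ⟨h₀, Or.inr ⟨h₁, h₂, h₃⟩⟩)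

end Move

/-! ### Partial commutators and folding of matrices -/

/-- The entry `(j, i)` of the commutator `[F, X]` of two `N × N` matrices. -/
def commEntry (N : ℕ) (F X : ℕ → ℕ → ℂ) (j i : ℕ) : ℂ :=
  ∑ k ∈ Finset.range N, (F j k * X k i - X j k * F k i)

/-- The part of `commEntry` contributed by the indices satisfying `P`. -/
noncomputable def commPart (N : ℕ) (P : ℕ → Prop) [DecidablePred P] (F X : ℕ → ℕ → ℂ) (j i : ℕ) :
    ℂ :=
  ∑ k ∈ Finset.range N, if P k then F j k * X k i - X j k * F k i else 0

theorem commPart_add_commPart_not (N : ℕ) (P : ℕ → Prop) [DecidablePred P]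
    (F X : ℕ → ℕ → ℂ) (j i : ℕ) :
    commPart N P F X j i + commPart N (fun k => ¬ P k) F X j i = commEntry N F X j i := by
  rw [commPart, commPart, commEntry, ← Finset.sum_add_distrib]
  refine Finset.sum_congr rfl fun k _ => ?_
  by_cases h : P k <;> simp [h]

theorem commPart_eq_zero_of_diagonal {N : ℕ} {P : ℕ → Prop} [DecidablePred P]
    {F X : ℕ → ℕ → ℂ} {j i : ℕ} (hi : P i) (hj : P j)
    (h₁ : ∀ k, P k → k ≠ i → X k i = 0) (h₂ : ∀ k, P k → k ≠ j → X j k = 0) (hiN : i < N)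
    (hjN : j < N) (h : F j i * X i i = X j j * F j i) : commPart N P F X j i = 0 := by
  have e : ∀ k, (if P k then F j k * X k i - X j k * F k i else 0) =
      (if k = i then F j i * X i i else 0) - (if k = j then X j j * F j i else 0) := by
    intro k
    by_cases hk : P k
    · have t₁ : F j k * X k i = if k = i then F j i * X i i else 0 := by
        split_ifs with hki
        · rw [hki]
        · rw [h₁ k hk hki, mul_zero]
      have t₂ : X j k * F k i = if k = j then X j j * F j i else 0 := by
        split_ifs with hkj
        · rw [hkj]
        · rw [h₂ k hk hkj, zero_mul]
      rw [if_pos hk, t₁, t₂]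
    · have hki : k ≠ i := fun h' => hk (h' ▸ hi)
      have hkj : k ≠ j := fun h' => hk (h' ▸ hj)
      simp [hk, hki, hkj]
  rw [commPart, Finset.sum_congr rfl fun k _ => e k, Finset.sum_sub_distrib]
  simp [hiN, hjN, h]

/-- The hypotheses on `F` and `X` for a seaweed with first top block of size `x` and first bottom
block of size `y < x`. The relations describe the arcs and the blocks beyond the first ones. -/
structure FoldData (x y N : ℕ) (F X : ℕ → ℕ → ℂ) (Aa Ab Sa Sb : ℕ → ℕ → Prop) : Prop where
  lt : y < x
  le : x ≤ N
  spec : ∀ i j, i ≠ j → (F j i ≠ 0 ↔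
    (j < i ∧ (i < x ∧ j < x ∧ i + j + 1 = x ∨ x ≤ i ∧ x ≤ j ∧ Aa i j)) ∨
    (i < j ∧ (i < y ∧ j < y ∧ i + j + 1 = y ∨ y ≤ i ∧ y ≤ j ∧ Ab i j)))
  supp : ∀ i j, X i j ≠ 0 →
    (j ≤ i ∧ (i < x ∧ j < x ∨ x ≤ i ∧ x ≤ j ∧ Sa i j)) ∨
    (i ≤ j ∧ (i < y ∧ j < y ∨ y ≤ i ∧ y ≤ j ∧ Sb i j))
  comm : ∀ i j, (j ≤ i ∧ (i < x ∧ j < x ∨ x ≤ i ∧ x ≤ j ∧ Sa i j)) ∨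
    (i ≤ j ∧ (i < y ∧ j < y ∨ y ≤ i ∧ y ≤ j ∧ Sb i j)) → commEntry N F X j i = 0

/-- The weight of the top arc that identifies `p` with its mirror image. -/
noncomputable def foldWeight (x y : ℕ) (F : ℕ → ℕ → ℂ) (p : ℕ) : ℂ :=
  if y ≤ p then F (x - 1 - p) p else 1

/-- A matrix moved along the top arcs of the first block. -/
noncomputable def mirrored (x y : ℕ) (F X : ℕ → ℕ → ℂ) (p q : ℕ) : ℂ :=
  (foldWeight x y F p)⁻¹ * X (x - 1 - p) (x - 1 - q) * foldWeight x y F q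

/-- The matrix of the folded seaweed. -/
noncomputable def foldMatrix (x y : ℕ) (F X : ℕ → ℕ → ℂ) (p q : ℕ) : ℂ :=
  if y ≤ p ∧ y ≤ q then X p q
  else if (x - y ≤ p ∧ p < x) ∧ (x - y ≤ q ∧ q < x) then mirrored x y F X p q else 0

/-- The functional of the folded seaweed. -/
noncomputable def foldFunctional (x y : ℕ) (F : ℕ → ℕ → ℂ) (p q : ℕ) : ℂ :=
  (if y ≤ p ∧ y ≤ q then F p q else 0) +
    if (x - y ≤ p ∧ p < x) ∧ (x - y ≤ q ∧ q < x) then mirrored x y F F p q else 0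

namespace FoldData

variable {x y N : ℕ} {F X : ℕ → ℕ → ℂ} {Aa Ab Sa Sb : ℕ → ℕ → Prop}

theorem zero_of_lt_of_le (D : FoldData x y N F X Aa Ab Sa Sb) {i j : ℕ} (hi : i < y) (hj : y ≤ j) :
    X i j = 0 := by
  by_contra h
  rcases D.supp i j h with ⟨_, h | h⟩ | ⟨_, h | h⟩ <;> omega

theorem zero_of_le_of_lt (D : FoldData x y N F X Aa Ab Sa Sb) {i j : ℕ} (hi : x ≤ i) (hj : j < x) :
    X i j = 0 := by
  have := D.lt
  by_contra h
  rcases D.supp i j h with ⟨_, h | h⟩ | ⟨_, h | h⟩ <;> omega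

theorem functional_zero (D : FoldData x y N F X Aa Ab Sa Sb) {i j : ℕ} (hi : y ≤ i) (hj : j < y)
    (h : i + j + 1 ≠ x) : F j i = 0 := by
  have := D.lt
  by_contra h'
  rcases (D.spec i j (by omega)).1 h' with ⟨_, h | h⟩ | ⟨_, h | h⟩ <;> omega

theorem weight_ne_zero (D : FoldData x y N F X Aa Ab Sa Sb) {p : ℕ} (hp : x - y ≤ p)
    (hpx : p < x) : foldWeight x y F p ≠ 0 := by
  have := D.lt
  unfold foldWeight
  split_ifs with h
  · exact (D.spec p (x - 1 - p) (by omega)).2 (Or.inl ⟨by omega, Or.inl ⟨by omega, by omega, by omega⟩⟩)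
  · exact one_ne_zero

/-- One term survives in each of the two sums: X vanishes from rows before y to columns from y on,
and across the cut at y the functional has only the top arcs of the first block. -/
theorem off_diagonal_eq (D : FoldData x y N F X Aa Ab Sa Sb) {i j : ℕ} (hi : y ≤ i) (hix : i < x)
    (hj : j < y) :
    F j (x - 1 - j) * X (x - 1 - j) i = X j (x - 1 - i) * F (x - 1 - i) i := by
  have hlt := D.lt
  have hle := D.le
  have h := D.comm i j (Or.inl ⟨by omega, Or.inl ⟨hix, by omega⟩⟩)
  rw [commEntry, Finset.sum_sub_distrib, sub_eq_zero] at h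
  rw [Finset.sum_eq_single (x - 1 - j), Finset.sum_eq_single (x - 1 - i)] at h
  · exact h
  · intro k _ hk
    rcases lt_or_ge k y with hk' | hk'
    · rw [D.functional_zero hi hk' (by omega), mul_zero]
    · rw [D.zero_of_lt_of_le hj hk', zero_mul]
  · intro h'
    simp at h'
    omega
  · intro k _ hk
    rcases lt_or_ge k y with hk' | hk'
    · rw [D.zero_of_lt_of_le hk' hi, mul_zero]
    · rw [D.functional_zero hk' hj (by omega), zero_mul]
  · intro h'
    simp at h'
    omega

/-- This is the consistency of the overlay: where kept and reflected indices overlap, both copies of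
X agree. The arc coefficients in `off_diagonal_eq` dictate the weights of `mirrored`. -/
theorem eq_mirrored (D : FoldData x y N F X Aa Ab Sa Sb) {p q : ℕ} (hp : x - y ≤ p) (hpx : p < x)
    (hpy : y ≤ p) (hqx : q < x) (hqy : y ≤ q) :
    X p q = mirrored x y F X p q := by
  have h := D.off_diagonal_eq (i := q) (j := x - 1 - p) hqy hqx (by omega)
  rw [show x - 1 - (x - 1 - p) = p by omega] at h
  have h₁ := D.weight_ne_zero hp hpx
  rw [mirrored]
  simp only [foldWeight, hpy, hqy, if_true] at h₁ ⊢
  rw [mul_assoc, ← h, inv_mul_cancel_left₀ h₁]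

/-- The folded top block is cut at x - y. The entries of X below that cut vanish because
`off_diagonal_eq` relates them to entries from before y to after y. -/
theorem zero_of_mem (D : FoldData x y N F X Aa Ab Sa Sb) {p q : ℕ} (hp : x - y ≤ p) (hpx : p < x)
    (hpy : y ≤ p) (hq : q < x - y) (hqy : y ≤ q) : X p q = 0 := by
  have h := D.off_diagonal_eq (i := q) (j := x - 1 - p) hqy (by omega) (by omega)
  have h₁ := D.weight_ne_zero hp hpx
  rw [show x - 1 - (x - 1 - p) = p by omega,
    D.zero_of_lt_of_le (i := x - 1 - p) (j := x - 1 - q) (by omega) (by omega), zero_mul] at h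
  simp only [foldWeight, hpy, if_true] at h₁
  exact (mul_eq_zero.1 h).resolve_left h₁

/-- The counterpart of `zero_of_mem` for the end of the shortened bottom block: now the kept entry
is zero by triangularity, which forces the reflected one to vanish. -/
theorem mirrored_zero (D : FoldData x y N F X Aa Ab Sa Sb) {p q : ℕ} (hp : x - y ≤ p)
    (hpy : p < y) (hq : x - y ≤ q) (hqx : q < x) (hqy : y ≤ q) : mirrored x y F X p q = 0 := by
  have hlt := D.lt
  have h := D.off_diagonal_eq (i := q) (j := x - 1 - p) hqy hqx (by omega)
  rw [show x - 1 - (x - 1 - p) = p by omega, D.zero_of_lt_of_le hpy hqy, mul_zero] at h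
  have h₁ := D.weight_ne_zero hq hqx
  simp only [foldWeight, hqy, if_true] at h₁
  rw [mirrored, (mul_eq_zero.1 h.symm).resolve_right h₁]
  simp

theorem foldMatrix_of_le (p q : ℕ) (hp : y ≤ p) (hq : y ≤ q) : foldMatrix x y F X p q = X p q :=
  if_pos ⟨hp, hq⟩

theorem foldMatrix_of_mem (D : FoldData x y N F X Aa Ab Sa Sb) {p q : ℕ} (hp : x - y ≤ p)
    (hpx : p < x) (hq : x - y ≤ q) (hqx : q < x) :
    foldMatrix x y F X p q = mirrored x y F X p q := by
  unfold foldMatrix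
  split_ifs with h h'
  · exact D.eq_mirrored hp hpx h.1 hqx h.2
  · rfl
  · exact (h' ⟨⟨hp, hpx⟩, hq, hqx⟩).elim

theorem foldMatrix_supp (D : FoldData x y N F X Aa Ab Sa Sb) {p q : ℕ}
    (h : foldMatrix x y F X p q ≠ 0) :
    (q ≤ p ∧ ((p < x - y ∧ q < x - y) ∨ (x - y ≤ p ∧ p < x ∧ x - y ≤ q ∧ q < x) ∨
        (x ≤ p ∧ x ≤ q ∧ Sa p q))) ∨
      (p ≤ q ∧ ((p < y ∧ q < y) ∨ (y ≤ p ∧ y ≤ q ∧ Sb p q))) := by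
  have hlt := D.lt
  by_cases h₁ : y ≤ p ∧ y ≤ q
  · rw [foldMatrix_of_le _ _ h₁.1 h₁.2] at h
    have h₂ := D.supp p q h
    have h₃ : ¬ (x - y ≤ p ∧ p < x ∧ q < x - y) := fun h' =>
      h (D.zero_of_mem h'.1 h'.2.1 h₁.1 h'.2.2 h₁.2)
    rcases h₂ with ⟨h₄, h₅ | h₅⟩ | ⟨h₄, h₅ | h₅⟩
    · refine Or.inl ⟨h₄, ?_⟩
      omega
    · exact Or.inl ⟨h₄, Or.inr (Or.inr h₅)⟩
    · omega
    · exact Or.inr ⟨h₄, Or.inr h₅⟩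
  · rw [foldMatrix, if_neg h₁] at h
    split_ifs at h with h₂
    · rcases le_or_gt q p with h₃ | h₃
      · exact Or.inl ⟨h₃, Or.inr (Or.inl ⟨h₂.1.1, h₂.1.2, h₂.2⟩)⟩
      · rcases lt_or_ge q y with h₄ | h₄
        · exact Or.inr ⟨h₃.le, Or.inl ⟨by omega, h₄⟩⟩
        · exact (h (D.mirrored_zero h₂.1.1 (by omega) h₂.2.1 h₂.2.2 h₄)).elim
    · exact (h rfl).elim

/-- No cancellation occurs off the diagonal. Where the two summands overlap, F contributes only
bottom arcs and the reflected part only top arcs, since p + q + 1 = x is impossible for p ≥ x - y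
and q ≥ y. -/
theorem foldFunctional_spec (D : FoldData x y N F X Aa Ab Sa Sb) {p q : ℕ} (hpq : p ≠ q)
    (hp : min y (x - y) ≤ p) :
    foldFunctional x y F q p ≠ 0 ↔
      (q < p ∧ (p ≠ q ∧ ((p < x - y ∧ q < x - y ∧ p + q + 1 = x) ∨
        (x - y ≤ p ∧ p < x ∧ x - y ≤ q ∧ q < x ∧ p + q + 1 + y = 2 * x)) ∨
        (x ≤ p ∧ x ≤ q ∧ Aa p q))) ∨
      (p < q ∧ ((p ≠ q ∧ p < y ∧ q < y ∧ p + q + 1 = x) ∨ (y ≤ p ∧ y ≤ q ∧ Ab p q))) := by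
  have hlt := D.lt
  have h₁ := D.spec p q hpq
  have h₂ : (x - y ≤ q ∧ q < x) ∧ (x - y ≤ p ∧ p < x) → (mirrored x y F F q p ≠ 0 ↔
      (q < p ∧ p + q + 1 + y = 2 * x) ∨ (p < q ∧ p + q + 1 = x)) := by
    rintro ⟨⟨h₃, h₄⟩, h₅, h₆⟩
    have hm : mirrored x y F F q p ≠ 0 ↔ F (x - 1 - q) (x - 1 - p) ≠ 0 := by
      simp [mirrored, D.weight_ne_zero h₃ h₄, D.weight_ne_zero h₅ h₆]
    rw [hm, D.spec _ _ (by omega)]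
    constructor
    · rintro (⟨_, h | h⟩ | ⟨_, h | h⟩) <;> omega
    · rintro (⟨_, h⟩ | ⟨_, h⟩)
      · exact Or.inr ⟨by omega, Or.inl ⟨by omega, by omega, by omega⟩⟩
      · exact Or.inl ⟨by omega, Or.inl ⟨by omega, by omega, by omega⟩⟩
  unfold foldFunctional
  by_cases hT : y ≤ q ∧ y ≤ p <;>
    by_cases hC : (x - y ≤ q ∧ q < x) ∧ (x - y ≤ p ∧ p < x)
  · rw [if_pos hT, if_pos hC]
    have h₂ := h₂ hC
    rcases lt_or_gt_of_ne hpq with h | h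
    · have h₃ : mirrored x y F F q p = 0 := by
        by_contra h₃
        have := h₂.1 h₃
        omega
      rw [h₃, add_zero, h₁]
      constructor
      · rintro (⟨_, h | h⟩ | ⟨_, h | h⟩)
        any_goals omega
        exact Or.inr ⟨‹_›, Or.inr h⟩
      · rintro (⟨_, h | h⟩ | ⟨_, h | h⟩)
        any_goals omega
        exact Or.inr ⟨‹_›, Or.inr h⟩
    · have h₃ : F q p = 0 := by
        by_contra h₃
        rcases h₁.1 h₃ with ⟨_, h | h⟩ | ⟨_, h | h⟩ <;> omega
      rw [h₃, zero_add, h₂]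
      constructor
      · rintro (h' | h')
        · exact Or.inl ⟨h'.1, Or.inl ⟨hpq, Or.inr ⟨by omega, by omega, by omega, by omega, h'.2⟩⟩⟩
        · omega
      · rintro (⟨_, h | h⟩ | ⟨_, h | h⟩)
        any_goals omega
  · rw [if_pos hT, if_neg hC, add_zero, h₁]
    constructor
    · rintro (⟨h₀, h | h⟩ | ⟨h₀, h | h⟩)
      · refine Or.inl ⟨h₀, Or.inl ⟨hpq, Or.inl ?_⟩⟩
        omega
      · exact Or.inl ⟨h₀, Or.inr h⟩
      · omega
      · exact Or.inr ⟨h₀, Or.inr h⟩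
    · rintro (⟨h₀, ⟨_, h | h⟩ | h⟩ | ⟨h₀, h | h⟩)
      · exact Or.inl ⟨h₀, Or.inl (by omega)⟩
      · omega
      · exact Or.inl ⟨h₀, Or.inr h⟩
      · omega
      · exact Or.inr ⟨h₀, Or.inr h⟩
  · rw [if_neg hT, if_pos hC, zero_add, h₂ hC]
    constructor
    · rintro (⟨h₀, h⟩ | ⟨h₀, h⟩)
      · exact Or.inl ⟨h₀, Or.inl ⟨hpq, Or.inr (by omega)⟩⟩
      · exact Or.inr ⟨h₀, Or.inl ⟨hpq, by omega⟩⟩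
    · rintro (⟨h₀, ⟨_, h | h⟩ | h⟩ | ⟨h₀, h | h⟩)
      · omega
      · exact Or.inl (by omega)
      · omega
      · exact Or.inr (by omega)
      · omega
  · rw [if_neg hT, if_neg hC, zero_add]
    refine iff_of_false (by simp) ?_
    rintro (⟨h₀, ⟨_, h | h⟩ | h⟩ | ⟨h₀, h | h⟩) <;> omega

/-- The whole commutator entry vanishes, so this part is minus the part over k < y. There X k i = 0,
and F k i can be nonzero only if k is the mirror image of i. -/
theorem commPart_upper (D : FoldData x y N F X Aa Ab Sa Sb) {i j : ℕ} (hi : y ≤ i)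
    (h : (j ≤ i ∧ (i < x ∧ j < x ∨ x ≤ i ∧ x ≤ j ∧ Sa i j)) ∨
      (i ≤ j ∧ (i < y ∧ j < y ∨ y ≤ i ∧ y ≤ j ∧ Sb i j))) :
    commPart N (fun k => y ≤ k) F X j i =
      if x - y ≤ i ∧ i < x then X j (x - 1 - i) * F (x - 1 - i) i else 0 := by
  have hlt := D.lt
  have hle := D.le
  have h₁ := commPart_add_commPart_not N (fun k => y ≤ k) F X j i
  rw [D.comm i j h] at h₁
  rw [eq_neg_of_add_eq_zero_left h₁, commPart]
  have h₂ : ∀ k ∈ Finset.range N, (if ¬ y ≤ k then F j k * X k i - X j k * F k i else 0) =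
      if k = x - 1 - i then
        (if x - y ≤ i ∧ i < x then -(X j (x - 1 - i) * F (x - 1 - i) i) else 0) else 0 := by
    intro k _
    by_cases hk : y ≤ k
    · rw [if_neg (by simpa using hk)]
      split_ifs
      · omega
      · rfl
      · rfl
    · rw [if_pos hk, D.zero_of_lt_of_le (by omega) hi, mul_zero, zero_sub]
      by_cases hki : i + k + 1 = x
      · rw [if_pos (by omega), if_pos (by omega), show k = x - 1 - i by omega]
      · rw [D.functional_zero hi (by omega) hki, mul_zero, neg_zero]
        split_ifs
        · omega
        · rfl
        · rfl
  rw [Finset.sum_congr rfl h₂, Finset.sum_ite_eq', if_pos (by simp; omega)]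
  split_ifs <;> simp

/-- Dual to `commPart_upper`: in the complementary part over k ≥ y, triangularity of X kills one
product, and the other survives only at the mirror image k = j. -/
theorem commPart_lower (D : FoldData x y N F X Aa Ab Sa Sb) {i j : ℕ} (hi : x - y ≤ i)
    (hix : i < x) (hj : x - y ≤ j) (hjx : j < x) :
    commPart N (fun k => ¬ y ≤ k) F X (x - 1 - j) (x - 1 - i) =
      if y ≤ j then -(F (x - 1 - j) j * X j (x - 1 - i)) else 0 := by
  have hlt := D.lt
  have hle := D.le
  have h₁ := commPart_add_commPart_not N (fun k => y ≤ k) F X (x - 1 - j) (x - 1 - i)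
  have h₀ : commEntry N F X (x - 1 - j) (x - 1 - i) = 0 := by
    refine D.comm _ _ ?_
    rcases le_total i j with h | h
    · exact Or.inl ⟨by omega, Or.inl ⟨by omega, by omega⟩⟩
    · exact Or.inr ⟨by omega, Or.inl ⟨by omega, by omega⟩⟩
  rw [h₀] at h₁
  rw [eq_neg_of_add_eq_zero_right h₁, commPart]
  have h₂ : ∀ k ∈ Finset.range N, (if y ≤ k then F (x - 1 - j) k * X k (x - 1 - i) -
        X (x - 1 - j) k * F k (x - 1 - i) else 0) =
      if k = j then (if y ≤ j then F (x - 1 - j) j * X j (x - 1 - i) else 0) else 0 := by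
    intro k _
    by_cases hk : y ≤ k
    · rw [if_pos hk, D.zero_of_lt_of_le (by omega) hk, zero_mul, sub_zero]
      by_cases hkj : k = j
      · rw [if_pos hkj, if_pos (by omega), hkj]
      · rw [D.functional_zero hk (by omega) (by omega), zero_mul, if_neg hkj]
    · rw [if_neg hk]
      split_ifs
      · omega
      · rfl
      · rfl
  rw [Finset.sum_congr rfl h₂, Finset.sum_ite_eq', if_pos (by simp; omega)]
  split_ifs <;> simp

/-- Termwise splitting of the commutator of the folded matrices. -/
theorem fold_term (D : FoldData x y N F X Aa Ab Sa Sb) {i j : ℕ} (k : ℕ)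
    (hi : min y (x - y) ≤ i)
    (h : (j ≤ i ∧ ((i < x - y ∧ j < x - y) ∨ (x - y ≤ i ∧ i < x ∧ x - y ≤ j ∧ j < x) ∨
        (x ≤ i ∧ x ≤ j ∧ Sa i j))) ∨
      (i ≤ j ∧ ((i < y ∧ j < y) ∨ (y ≤ i ∧ y ≤ j ∧ Sb i j)))) :
    foldFunctional x y F j k * foldMatrix x y F X k i -
        foldMatrix x y F X j k * foldFunctional x y F k i =
      (if (y ≤ i ∧ y ≤ j) ∧ y ≤ k then F j k * X k i - X j k * F k i else 0) +
      if ((x - y ≤ i ∧ i < x) ∧ (x - y ≤ j ∧ j < x)) ∧ (x - y ≤ k ∧ k < x) then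
        mirrored x y F F j k * mirrored x y F X k i -
          mirrored x y F X j k * mirrored x y F F k i else 0 := by
  have hlt := D.lt
  have h' : (j ≤ i ∧ ((i < x - y ∧ j < x - y) ∨ (x - y ≤ i ∧ i < x ∧ x - y ≤ j ∧ j < x) ∨
        (x ≤ i ∧ x ≤ j))) ∨ (i ≤ j ∧ ((i < y ∧ j < y) ∨ (y ≤ i ∧ y ≤ j))) := by
    rcases h with ⟨h₀, h | h | h⟩ | ⟨h₀, h | h⟩
    · exact Or.inl ⟨h₀, Or.inl h⟩
    · exact Or.inl ⟨h₀, Or.inr (Or.inl h)⟩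
    · exact Or.inl ⟨h₀, Or.inr (Or.inr ⟨h.1, h.2.1⟩)⟩
    · exact Or.inr ⟨h₀, Or.inl h⟩
    · exact Or.inr ⟨h₀, Or.inr ⟨h.1, h.2.1⟩⟩
  clear h
  have e₁ : (if y ≤ j ∧ y ≤ k then F j k else 0) * foldMatrix x y F X k i =
      if (y ≤ i ∧ y ≤ j) ∧ y ≤ k then F j k * X k i else 0 := by
    by_cases h₁ : y ≤ j ∧ y ≤ k
    · have h₂ : y ≤ i := by omega
      rw [if_pos h₁, if_pos ⟨⟨h₂, h₁.1⟩, h₁.2⟩, foldMatrix_of_le _ _ h₁.2 h₂]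
    · rw [if_neg h₁, if_neg (by tauto), zero_mul]
  have e₂ : foldMatrix x y F X j k * (if y ≤ k ∧ y ≤ i then F k i else 0) =
      if (y ≤ i ∧ y ≤ j) ∧ y ≤ k then X j k * F k i else 0 := by
    by_cases h₁ : y ≤ k ∧ y ≤ i
    · rw [if_pos h₁]
      by_cases h₂ : y ≤ j
      · rw [if_pos ⟨⟨h₁.2, h₂⟩, h₁.1⟩, foldMatrix_of_le _ _ h₂ h₁.1]
      · have h₃ : foldMatrix x y F X j k = 0 := by
          rw [foldMatrix, if_neg (by tauto)]
          split_ifs with h₄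
          · exact D.mirrored_zero h₄.1.1 (by omega) h₄.2.1 h₄.2.2 h₁.1
          · rfl
        rw [h₃, if_neg (by tauto), zero_mul]
    · rw [if_neg h₁, if_neg (by tauto), mul_zero]
  have e₃ : (if (x - y ≤ j ∧ j < x) ∧ (x - y ≤ k ∧ k < x) then mirrored x y F F j k else 0) *
        foldMatrix x y F X k i =
      if ((x - y ≤ i ∧ i < x) ∧ (x - y ≤ j ∧ j < x)) ∧ (x - y ≤ k ∧ k < x) then
        mirrored x y F F j k * mirrored x y F X k i else 0 := by
    by_cases h₁ : (x - y ≤ j ∧ j < x) ∧ (x - y ≤ k ∧ k < x)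
    · rw [if_pos h₁]
      by_cases h₂ : x - y ≤ i ∧ i < x
      · rw [if_pos ⟨⟨h₂, h₁.1⟩, h₁.2⟩, D.foldMatrix_of_mem h₁.2.1 h₁.2.2 h₂.1 h₂.2]
      · have h₃ : foldMatrix x y F X k i = 0 := by
          rw [foldMatrix_of_le _ _ (by omega) (by omega)]
          exact D.zero_of_mem h₁.2.1 h₁.2.2 (by omega) (by omega) (by omega)
        rw [h₃, if_neg (by tauto), mul_zero]
    · rw [if_neg h₁, if_neg (by tauto), zero_mul]
  have e₄ : foldMatrix x y F X j k *
        (if (x - y ≤ k ∧ k < x) ∧ (x - y ≤ i ∧ i < x) then mirrored x y F F k i else 0) =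
      if ((x - y ≤ i ∧ i < x) ∧ (x - y ≤ j ∧ j < x)) ∧ (x - y ≤ k ∧ k < x) then
        mirrored x y F X j k * mirrored x y F F k i else 0 := by
    by_cases h₁ : (x - y ≤ k ∧ k < x) ∧ (x - y ≤ i ∧ i < x)
    · rw [if_pos h₁]
      by_cases h₂ : x - y ≤ j ∧ j < x
      · rw [if_pos ⟨⟨h₁.2, h₂⟩, h₁.1⟩, D.foldMatrix_of_mem h₂.1 h₂.2 h₁.1.1 h₁.1.2]
      · have h₃ : foldMatrix x y F X j k = 0 := by
          have h₄ : x ≤ j := by omega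
          unfold foldMatrix
          split_ifs
          · exact D.zero_of_le_of_lt h₄ h₁.1.2
          · omega
          · rfl
        rw [h₃, if_neg (by tauto), zero_mul]
    · rw [if_neg h₁, if_neg (by tauto), mul_zero]
  rw [foldFunctional, foldFunctional, add_mul, mul_add, e₁, e₂, e₃, e₄]
  split_ifs <;> ring

/-- The weights at the summation index cancel, so reflection conjugates the partial commutator. -/
theorem sum_mirrored (D : FoldData x y N F X Aa Ab Sa Sb) (i j : ℕ) :
    (∑ k ∈ Finset.range N, if x - y ≤ k ∧ k < x then
      mirrored x y F F j k * mirrored x y F X k i -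
          mirrored x y F X j k * mirrored x y F F k i else 0) =
      (foldWeight x y F j)⁻¹ *
        commPart N (fun k => ¬ y ≤ k) F X (x - 1 - j) (x - 1 - i) * foldWeight x y F i := by
  have hlt := D.lt
  have hle := D.le
  rw [commPart, Finset.mul_sum, Finset.sum_mul, ← Finset.sum_filter]
  simp only [mul_ite, ite_mul, mul_zero, zero_mul]
  rw [← Finset.sum_filter]
  refine Finset.sum_nbij' (fun k => x - 1 - k) (fun k => x - 1 - k) ?_ ?_ ?_ ?_ ?_
  · intro k hk
    simp only [Finset.mem_filter, Finset.mem_range] at hk ⊢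
    omega
  · intro k hk
    simp only [Finset.mem_filter, Finset.mem_range] at hk ⊢
    omega
  · intro k hk
    simp only [Finset.mem_filter, Finset.mem_range] at hk
    omega
  · intro k hk
    simp only [Finset.mem_filter, Finset.mem_range] at hk
    omega
  · intro k hk
    simp only [Finset.mem_filter, Finset.mem_range] at hk
    have := D.weight_ne_zero hk.2.1 hk.2.2
    simp only [mirrored]
    field_simp

/-- By `fold_term` the folded commutator is the kept part plus the reflected part. Their defects
come from `commPart_upper` and `commPart_lower`; after conjugation by the weights these are the same
product with opposite signs. At the remaining locations each defect vanishes separately. -/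
theorem fold_comm (D : FoldData x y N F X Aa Ab Sa Sb) {i j : ℕ}
    (hi : min y (x - y) ≤ i)
    (h : (j ≤ i ∧ ((i < x - y ∧ j < x - y) ∨ (x - y ≤ i ∧ i < x ∧ x - y ≤ j ∧ j < x) ∨
        (x ≤ i ∧ x ≤ j ∧ Sa i j))) ∨
      (i ≤ j ∧ ((i < y ∧ j < y) ∨ (y ≤ i ∧ y ≤ j ∧ Sb i j)))) :
    commEntry N (foldFunctional x y F) (foldMatrix x y F X) j i = 0 := by
  have hlt := D.lt
  have hle := D.le
  rw [commEntry, Finset.sum_congr rfl fun k _ => D.fold_term k hi h, Finset.sum_add_distrib]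
  have e₁ : (∑ k ∈ Finset.range N, if (y ≤ i ∧ y ≤ j) ∧ y ≤ k then
      F j k * X k i - X j k * F k i else 0) =
      if y ≤ i ∧ y ≤ j then (if x - y ≤ i ∧ i < x then X j (x - 1 - i) * F (x - 1 - i) i else 0)
        else 0 := by
    by_cases h₁ : y ≤ i ∧ y ≤ j
    · simp only [h₁, and_self, true_and, if_true]
      refine D.commPart_upper h₁.1 ?_
      rcases h with ⟨h₀, h | h | h⟩ | ⟨h₀, h | h⟩
      · exact Or.inl ⟨h₀, Or.inl (by omega)⟩
      · exact Or.inl ⟨h₀, Or.inl (by omega)⟩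
      · exact Or.inl ⟨h₀, Or.inr h⟩
      · omega
      · exact Or.inr ⟨h₀, Or.inr h⟩
    · simp only [h₁, false_and, if_false, Finset.sum_const_zero]
  have e₂ : (∑ k ∈ Finset.range N, if ((x - y ≤ i ∧ i < x) ∧ (x - y ≤ j ∧ j < x)) ∧
      (x - y ≤ k ∧ k < x) then mirrored x y F F j k * mirrored x y F X k i -
          mirrored x y F X j k * mirrored x y F F k i else 0) =
      if (x - y ≤ i ∧ i < x) ∧ (x - y ≤ j ∧ j < x) then
        (if y ≤ j then -(X j (x - 1 - i) * foldWeight x y F i) else 0) else 0 := by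
    by_cases h₁ : (x - y ≤ i ∧ i < x) ∧ (x - y ≤ j ∧ j < x)
    · simp only [h₁, and_self, true_and, if_true]
      rw [D.sum_mirrored,
        D.commPart_lower h₁.1.1 h₁.1.2 h₁.2.1 h₁.2.2]
      have hw := D.weight_ne_zero h₁.2.1 h₁.2.2
      split_ifs with h₂
      · have : F (x - 1 - j) j = foldWeight x y F j := by simp [foldWeight, h₂]
        rw [this]
        field_simp
      · simp
    · simp only [h₁, false_and, if_false, Finset.sum_const_zero]
  rw [e₁, e₂]
  by_cases h₁ : y ≤ i ∧ y ≤ j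
  · rw [if_pos h₁]
    by_cases h₂ : x - y ≤ i ∧ i < x
    · have hw : foldWeight x y F i = F (x - 1 - i) i := by simp [foldWeight, h₁.1]
      rw [if_pos h₂]
      by_cases h₃ : x - y ≤ j ∧ j < x
      · rw [if_pos ⟨h₂, h₃⟩, if_pos h₁.2, hw]
        ring
      · rw [if_neg (by tauto), add_zero]
        have : x ≤ j := by
          rcases h with ⟨h₀, h | h | h⟩ | ⟨h₀, h | h⟩ <;> omega
        rw [D.zero_of_le_of_lt this (by omega), zero_mul]
    · rw [if_neg h₂, if_neg (by tauto), add_zero]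
  · rw [if_neg h₁, zero_add]
    split_ifs with h₂ h₃
    · rcases h with ⟨h₀, h | h | h⟩ | ⟨h₀, h | h⟩ <;> omega
    · rfl
    · rfl

theorem mirrored_self (D : FoldData x y N F X Aa Ab Sa Sb) {p : ℕ} (hp : x - y ≤ p)
    (hpx : p < x) : mirrored x y F X p p = X (x - 1 - p) (x - 1 - p) := by
  have := D.weight_ne_zero hp hpx
  rw [mirrored]
  field_simp

/-- A matrix is diagonal and constant along the support of the functional, if the folded matrix
is so. -/
theorem diagonal_of_fold (D : FoldData x y N F X Aa Ab Sa Sb)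
    (hd : ∀ p q, min y (x - y) ≤ p → min y (x - y) ≤ q → p ≠ q → foldMatrix x y F X p q = 0)
    (hc : ∀ p q, min y (x - y) ≤ p → min y (x - y) ≤ q → p ≠ q → foldFunctional x y F q p ≠ 0 →
      foldMatrix x y F X p p = foldMatrix x y F X q q) :
    (∀ i j, i ≠ j → X i j = 0) ∧ ∀ i j, i ≠ j → F j i ≠ 0 → X i i = X j j := by
  have hlt := D.lt
  have hle := D.le
  have dT : ∀ p q, y ≤ p → y ≤ q → p ≠ q → X p q = 0 := fun p q hp hq h => by
    rw [← foldMatrix_of_le (x := x) (F := F) (X := X) p q hp hq]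
    exact hd p q (by omega) (by omega) h
  have dS : ∀ p q, p < y → q < y → p ≠ q → X p q = 0 := fun p q hp hq h => by
    have h₁ := hd (x - 1 - p) (x - 1 - q) (by omega) (by omega) (by omega)
    rw [D.foldMatrix_of_mem (by omega) (by omega) (by omega) (by omega), mirrored,
      show x - 1 - (x - 1 - p) = p by omega, show x - 1 - (x - 1 - q) = q by omega] at h₁
    have h₂ := D.weight_ne_zero (p := x - 1 - p) (by omega) (by omega)
    have h₃ := D.weight_ne_zero (p := x - 1 - q) (by omega) (by omega)
    simpa [h₂, h₃] using h₁
  have mS : ∀ p, p < y → foldMatrix x y F X (x - 1 - p) (x - 1 - p) = X p p := fun p hp => by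
    rw [D.foldMatrix_of_mem (by omega) (by omega) (by omega) (by omega),
      D.mirrored_self (by omega) (by omega), show x - 1 - (x - 1 - p) = p by omega]
  have cT : ∀ p q, y ≤ p → y ≤ q → p ≠ q → F q p ≠ 0 → X p p = X q q :=
    fun p q hp hq hpq h => by
    rw [← foldMatrix_of_le (x := x) (F := F) (X := X) p p hp hp,
      ← foldMatrix_of_le (x := x) (F := F) (X := X) q q hq hq]
    refine hc p q (by omega) (by omega) hpq ((D.foldFunctional_spec hpq (by omega)).2 ?_)
    rcases (D.spec p q hpq).1 h with ⟨h₀, h | h⟩ | ⟨h₀, h | h⟩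
    · exact Or.inl ⟨h₀, Or.inl ⟨hpq, Or.inl (by omega)⟩⟩
    · exact Or.inl ⟨h₀, Or.inr h⟩
    · omega
    · exact Or.inr ⟨h₀, Or.inr h⟩
  have cS : ∀ p q, p < y → q < y → p ≠ q → F q p ≠ 0 → X p p = X q q :=
    fun p q hp hq hpq h => by
    rw [← mS p hp, ← mS q hq]
    have hpq' : x - 1 - p ≠ x - 1 - q := by omega
    refine hc _ _ (by omega) (by omega) hpq' ((D.foldFunctional_spec hpq' (by omega)).2 ?_)
    rcases (D.spec p q hpq).1 h with ⟨h₀, h | h⟩ | ⟨h₀, h | h⟩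
    · exact Or.inr ⟨by omega, Or.inl ⟨hpq', by omega⟩⟩
    · omega
    · exact Or.inl ⟨by omega, Or.inl ⟨hpq', Or.inr (by omega)⟩⟩
    · omega
  have pT : ∀ i j, y ≤ i → y ≤ j → i < x → j < x → commPart N (fun k => y ≤ k) F X j i = 0 := by
    intro i j hi hj hix hjx
    refine commPart_eq_zero_of_diagonal hi hj (fun k hk hki => dT k i hk hi hki)
      (fun k hk hkj => dT j k hj hk hkj.symm) (by omega) (by omega) ?_
    by_cases hij : i = j
    · rw [hij, mul_comm]
    · by_cases hF : F j i = 0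
      · rw [hF, zero_mul, mul_zero]
      · rw [cT i j hi hj hij hF, mul_comm]
  have pS : ∀ i j, i < y → j < y → commPart N (fun k => ¬ y ≤ k) F X j i = 0 := by
    intro i j hi hj
    refine commPart_eq_zero_of_diagonal (by omega) (by omega)
      (fun k hk hki => dS k i (by omega) hi hki)
      (fun k hk hkj => dS j k hj (by omega) hkj.symm) (by omega) (by omega) ?_
    by_cases hij : i = j
    · rw [hij, mul_comm]
    · by_cases hF : F j i = 0
      · rw [hF, zero_mul, mul_zero]
      · rw [cS i j hi hj hij hF, mul_comm]
  -- Once both diagonal blocks are diagonal and constant along arcs, the partial commutators vanish.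
  -- `commPart_lower` and `commPart_upper` express them, up to sign, as an entry of the lower left
  -- block times a nonzero arc coefficient, so that entry is zero.
  have dQ : ∀ j s, y ≤ j → s < y → X j s = 0 := by
    intro j s hj hs
    by_cases hjx : j < x
    · by_cases hjC : x - y ≤ j
      · have h₁ := pS s (x - 1 - j) hs (by omega)
        have h₂ := D.commPart_lower (i := x - 1 - s) (j := j) (by omega) (by omega) hjC hjx
        rw [show x - 1 - (x - 1 - s) = s by omega, h₁, if_pos hj] at h₂
        have h₃ := D.weight_ne_zero hjC hjx
        simp only [foldWeight, hj, if_true] at h₃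
        simpa [h₃] using h₂.symm
      · have h₁ := pT (x - 1 - s) j (by omega) hj (by omega) hjx
        have h₂ := D.commPart_upper (i := x - 1 - s) (j := j) (by omega)
          (Or.inl ⟨by omega, Or.inl ⟨by omega, by omega⟩⟩)
        rw [show x - 1 - (x - 1 - s) = s by omega, h₁, if_pos (by omega)] at h₂
        have h₃ := D.weight_ne_zero (p := x - 1 - s) (by omega) (by omega)
        rw [foldWeight, if_pos (by omega), show x - 1 - (x - 1 - s) = s by omega] at h₃
        simpa [h₃] using h₂.symm
    · exact D.zero_of_le_of_lt (by omega) (by omega)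
  refine ⟨fun i j hij => ?_, fun i j hij hF => ?_⟩
  · rcases lt_or_ge i y with hi | hi <;> rcases lt_or_ge j y with hj | hj
    · exact dS i j hi hj hij
    · exact D.zero_of_lt_of_le hi hj
    · exact dQ i j hi hj
    · exact dT i j hi hj hij
  · rcases lt_or_ge i y with hi | hi <;> rcases lt_or_ge j y with hj | hj
    · exact cS i j hi hj hij hF
    · rcases (D.spec i j hij).1 hF with ⟨h₀, h | h⟩ | ⟨h₀, h | h⟩ <;> omega
    · have hs : i + j + 1 = x := by
        by_contra h
        exact hF (D.functional_zero hi hj h)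
      rw [← mS j hj, show x - 1 - j = i by omega, foldMatrix_of_le _ _ hi hi]
    · exact cT i j hi hj hij hF

end FoldData

/-! ### Kernels for type-A seaweeds without cycles -/

theorem AdmissibleA.swap {a b : List ℕ} {i j : ℕ} (h : AdmissibleA a b i j) :
    AdmissibleA b a j i :=
  h.elim (fun h => Or.inr ⟨h.1, h.2.symm⟩) (fun h => Or.inl ⟨h.1, h.2.symm⟩)

theorem AdmissibleA.lt {a b : List ℕ} {N i j : ℕ} (ha : a.sum = N) (hb : b.sum = N)
    (h : AdmissibleA a b i j) : i < N ∧ j < N := by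
  rcases h with ⟨_, h⟩ | ⟨_, h⟩
  · exact ⟨ha ▸ h.lt_sum, ha ▸ h.symm.lt_sum⟩
  · exact ⟨hb ▸ h.lt_sum, hb ▸ h.symm.lt_sum⟩

/-- `X` lies in the kernel of the Kirillov form of the functional `Y ↦ tr (F Y)` on the type-A
seaweed of `a` and `b`, where `F` is supported on the diagonal and on the arcs of the meander. -/
structure KernelData (N : ℕ) (a b : List ℕ) (F X : ℕ → ℕ → ℂ) : Prop where
  sum_top : a.sum = N
  sum_bottom : b.sum = N
  grading : ∃ g : ℕ → ℤ, IsGraded 2 a b g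
  spec : ∀ i j, i ≠ j → (F j i ≠ 0 ↔ DirectedArc a b i j)
  supp : ∀ i j, X i j ≠ 0 → AdmissibleA a b i j
  comm : ∀ i j, AdmissibleA a b i j → commEntry N F X j i = 0

/-- `X` is diagonal and constant along the support of `F`. -/
def IsDiagonalAlong (F X : ℕ → ℕ → ℂ) : Prop :=
  (∀ i j, i ≠ j → X i j = 0) ∧ ∀ i j, i ≠ j → F j i ≠ 0 → X i i = X j j

namespace KernelData

variable {N : ℕ} {a b : List ℕ} {F X : ℕ → ℕ → ℂ}

/-- Transposing both matrices exchanges top and bottom, reverses the arcs and changes the sign of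
the commutator. -/
theorem swap (D : KernelData N a b F X) :
    KernelData N b a (fun i j => F j i) (fun i j => X j i) where
  sum_top := D.sum_bottom
  sum_bottom := D.sum_top
  grading := by
    obtain ⟨g, hg⟩ := D.grading
    exact ⟨_, hg.swap⟩
  spec i j hij := (D.spec j i hij.symm).trans ⟨DirectedArc.swap, DirectedArc.swap⟩
  supp i j h := (D.supp j i h).swap
  comm i j h := by
    have := D.comm j i h.swap
    rw [commEntry] at this ⊢
    rw [← neg_eq_zero, ← this, ← Finset.sum_neg_distrib]
    exact Finset.sum_congr rfl fun k _ => by ring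

theorem isDiagonalAlong_of_swap
    (h : IsDiagonalAlong (fun i j => F j i) (fun i j => X j i)) : IsDiagonalAlong F X :=
  ⟨fun i j hij => h.1 j i hij.symm, fun i j hij hF => (h.2 j i hij.symm hF).symm⟩

theorem foldData {x y : ℕ} (D : KernelData N (x :: a) (y :: b) F X) (hyx : y < x) :
    FoldData x y N F X (fun i j => Arc a (i - x) (j - x)) (fun i j => Arc b (i - y) (j - y))
      (fun i j => SameBlock a (i - x) (j - x)) (fun i j => SameBlock b (i - y) (j - y)) where
  lt := hyx
  le := by
    have := D.sum_top
    rw [List.sum_cons] at this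
    omega
  spec i j hij := by
    rw [D.spec i j hij]
    simp only [DirectedArc, Arc, ne_eq, hij, not_false_eq_true, true_and]
  supp i j h := D.supp i j h
  comm i j h := D.comm i j h

theorem fold {x y : ℕ} (D : KernelData N (x :: a) (y :: b) F X) (hyx : y < x) :
    KernelData (N - min y (x - y)) ((x - 2 * y) :: y :: a) ((2 * y - x) :: b)
      (fun i j => foldFunctional x y F (i + min y (x - y)) (j + min y (x - y)))
      (fun i j => foldMatrix x y F X (i + min y (x - y)) (j + min y (x - y))) := by
  obtain ⟨m, hm⟩ : ∃ m, m = min y (x - y) := ⟨_, rfl⟩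
  have Q := D.foldData hyx
  have st := fun i j => sameBlock_top_move (a := a) hyx hm (Nat.le_add_left m i)
    (Nat.le_add_left m j)
  have sb := fun i j => sameBlock_bottom_move (b := b) hyx hm (Nat.le_add_left m i)
    (Nat.le_add_left m j)
  have arc := fun i j => directedArc_move (a := a) (b := b) hyx hm (Nat.le_add_left m i)
    (Nat.le_add_left m j)
  simp only [add_tsub_cancel_right] at st sb arc
  have hs := D.sum_top
  have hs' := D.sum_bottom
  rw [List.sum_cons] at hs hs'
  have adm : ∀ i j, AdmissibleA ((x - 2 * y) :: y :: a) ((2 * y - x) :: b) i j ↔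
      (j + m ≤ i + m ∧ ((i + m < x - y ∧ j + m < x - y) ∨
        (x - y ≤ i + m ∧ i + m < x ∧ x - y ≤ j + m ∧ j + m < x) ∨
        (x ≤ i + m ∧ x ≤ j + m ∧ SameBlock a (i + m - x) (j + m - x)))) ∨
      (i + m ≤ j + m ∧ ((i + m < y ∧ j + m < y) ∨
        (y ≤ i + m ∧ y ≤ j + m ∧ SameBlock b (i + m - y) (j + m - y)))) := by
    intro i j
    rw [AdmissibleA, st, sb, add_le_add_iff_right, add_le_add_iff_right]
  rw [← hm]
  refine ⟨?_, ?_, ?_, ?_, ?_, ?_⟩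
  · simp only [List.sum_cons]
    omega
  · simp only [List.sum_cons]
    omega
  · obtain ⟨g, hg⟩ := D.grading
    exact ⟨_, hg.wind hyx hm⟩
  · intro i j hij
    rw [Q.foldFunctional_spec (by omega) (by omega), arc]
  · intro i j h
    exact (adm i j).2 (Q.foldMatrix_supp h)
  · intro i j h
    have h₁ := Q.fold_comm (by omega) ((adm i j).1 h)
    have hz : ∀ p q, p < m ∨ q < m → foldMatrix x y F X p q = 0 := by
      intro p q hpq
      rw [foldMatrix, if_neg (by omega), if_neg (by omega)]
    rw [commEntry, Finset.range_eq_Ico, ← Finset.sum_Ico_consecutive _ (Nat.zero_le m) (by omega),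
      Finset.sum_eq_zero, zero_add, Finset.sum_Ico_eq_sum_range] at h₁
    · rw [commEntry, ← h₁]
      exact Finset.sum_congr rfl fun k _ => by rw [add_comm m k]
    · intro k hk
      rw [Finset.mem_Ico] at hk
      rw [hz _ _ (Or.inl hk.2), hz _ _ (Or.inr hk.2)]
      ring

theorem isDiagonalAlong_of_fold {x y : ℕ} (D : KernelData N (x :: a) (y :: b) F X) (hyx : y < x)
    (h : IsDiagonalAlong
      (fun i j => foldFunctional x y F (i + min y (x - y)) (j + min y (x - y)))
      (fun i j => foldMatrix x y F X (i + min y (x - y)) (j + min y (x - y)))) :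
    IsDiagonalAlong F X := by
  refine (D.foldData hyx).diagonal_of_fold (fun p q hp hq hpq => ?_) (fun p q hp hq hpq hF => ?_)
  · obtain ⟨P, rfl⟩ := Nat.exists_eq_add_of_le' hp
    obtain ⟨Q, rfl⟩ := Nat.exists_eq_add_of_le' hq
    exact h.1 P Q (by omega)
  · obtain ⟨P, rfl⟩ := Nat.exists_eq_add_of_le' hp
    obtain ⟨Q, rfl⟩ := Nat.exists_eq_add_of_le' hq
    exact h.2 P Q (by omega) hF

/-- In equal blocks of size above 1 the outermost top and bottom arcs form a cycle, around which the
grading would rise by 4. -/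
theorem block_eq_one {x : ℕ} (D : KernelData N (x :: a) (x :: b) F X) (hx : 0 < x) : x = 1 := by
  by_contra h
  obtain ⟨g, hg⟩ := D.grading
  have h₁ := hg 0 (x - 1) (Or.inr ⟨by omega, Or.inl ⟨by omega, by omega, by omega, by omega⟩⟩)
  have h₂ := hg (x - 1) 0 (Or.inl ⟨by omega, Or.inl ⟨by omega, by omega, by omega, by omega⟩⟩)
  omega

theorem corner_zero (D : KernelData N (1 :: a) (1 :: b) F X) {i j : ℕ} (hij : i ≠ j)
    (h : i = 0 ∨ j = 0) : X i j = 0 := by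
  by_contra hX
  rcases D.supp i j hX with ⟨_, h | h⟩ | ⟨_, h | h⟩ <;> omega

/-- X has no off-diagonal entry in row or column 0, so index 0 contributes nothing to the other
commutator entries. -/
theorem tail (D : KernelData N (1 :: a) (1 :: b) F X) :
    KernelData (N - 1) a b (fun i j => F (i + 1) (j + 1)) (fun i j => X (i + 1) (j + 1)) := by
  have hs := D.sum_top
  have hs' := D.sum_bottom
  rw [List.sum_cons] at hs hs'
  have arc : ∀ (c : List ℕ) i j, Arc (1 :: c) (i + 1) (j + 1) ↔ Arc c i j := by
    intro c i j
    simp [Arc]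
  have block : ∀ (c : List ℕ) i j, SameBlock (1 :: c) (i + 1) (j + 1) ↔ SameBlock c i j := by
    intro c i j
    simp [SameBlock]
  have dir : ∀ i j, DirectedArc (1 :: a) (1 :: b) (i + 1) (j + 1) ↔ DirectedArc a b i j := by
    intro i j
    simp [DirectedArc, arc]
  have adm : ∀ i j, AdmissibleA (1 :: a) (1 :: b) (i + 1) (j + 1) ↔ AdmissibleA a b i j := by
    intro i j
    simp [AdmissibleA, block]
  refine ⟨by omega, by omega, ?_, ?_, ?_, ?_⟩
  · obtain ⟨g, hg⟩ := D.grading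
    exact ⟨fun i => g (i + 1), fun i j h => hg _ _ ((dir i j).2 h)⟩
  · intro i j hij
    rw [D.spec _ _ (by omega), dir]
  · exact fun i j h => (adm i j).1 (D.supp _ _ h)
  · intro i j h
    have h₁ := D.comm _ _ ((adm i j).2 h)
    rw [commEntry, show N = (N - 1) + 1 by omega, Finset.sum_range_succ',
      D.corner_zero (i := 0) (by omega) (Or.inl rfl), D.corner_zero (j := 0) (by omega) (Or.inr rfl),
      mul_zero, zero_mul, sub_zero, add_zero] at h₁
    exact h₁

theorem isDiagonalAlong_of_tail (D : KernelData N (1 :: a) (1 :: b) F X)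
    (h : IsDiagonalAlong (fun i j => F (i + 1) (j + 1)) (fun i j => X (i + 1) (j + 1))) :
    IsDiagonalAlong F X := by
  refine ⟨fun i j hij => ?_, fun i j hij hF => ?_⟩
  · by_cases h₀ : i = 0 ∨ j = 0
    · exact D.corner_zero hij h₀
    · obtain ⟨i, rfl⟩ := Nat.exists_eq_succ_of_ne_zero (fun h => h₀ (Or.inl h))
      obtain ⟨j, rfl⟩ := Nat.exists_eq_succ_of_ne_zero (fun h => h₀ (Or.inr h))
      exact h.1 i j (by omega)
  · by_cases h₀ : i = 0 ∨ j = 0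
    · rcases (D.spec i j hij).1 hF with ⟨_, h | h⟩ | ⟨_, h | h⟩ <;> omega
    · obtain ⟨i, rfl⟩ := Nat.exists_eq_succ_of_ne_zero (fun h => h₀ (Or.inl h))
      obtain ⟨j, rfl⟩ := Nat.exists_eq_succ_of_ne_zero (fun h => h₀ (Or.inr h))
      exact h.2 i j (by omega) hF

theorem drop_top_zero (D : KernelData N (0 :: a) b F X) : KernelData N a b F X := by
  refine ⟨by simpa using D.sum_top, D.sum_bottom, ?_, ?_, ?_, ?_⟩
  · simpa only [IsGraded, DirectedArc, arc_zero_cons] using D.grading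
  · simpa only [DirectedArc, arc_zero_cons] using D.spec
  · simpa only [AdmissibleA, sameBlock_zero_cons] using D.supp
  · simpa only [AdmissibleA, sameBlock_zero_cons] using D.comm

theorem isDiagonalAlong_of_sum_eq_zero (D : KernelData N a b F X) (hN : N = 0) :
    IsDiagonalAlong F X := by
  have h : ∀ i j, X i j = 0 := by
    intro i j
    by_contra h
    have := ((D.supp i j h).lt D.sum_top D.sum_bottom).1
    omega
  exact ⟨fun i j _ => h i j, fun i j _ _ => by rw [h, h]⟩

/-- If the meander has no cycle, then the kernel of the Kirillov form on the type-A seaweed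
consists of diagonal matrices that are constant along the arcs. -/
theorem isDiagonalAlong (D : KernelData N a b F X) : IsDiagonalAlong F X := by
  -- Dropping a block of size 0 leaves N unchanged, so the lengths belong to the measure.
  induction h : N + a.length + b.length using Nat.strong_induction_on generalizing N a b F X with
  | _ n ih =>
    subst h
    have step : ∀ {N a b F X x y} (_ : KernelData N (x :: a) (y :: b) F X), 0 < y → y < x →
        (∀ m < N + (x :: a).length + (y :: b).length, ∀ {N a b F X}, KernelData N a b F X →
          N + a.length + b.length = m → IsDiagonalAlong F X) → IsDiagonalAlong F X := by
      intro N a b F X x y D hy hyx ih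
      have hs := D.sum_top
      have hs' := D.sum_bottom
      rw [List.sum_cons] at hs hs'
      -- At least one of x - 2y and 2y - x is zero. Dropping that block restores the total length,
      -- while N has decreased.
      rcases eq_or_ne (x - 2 * y) 0 with h | h
      · have D' := D.fold hyx
        rw [h] at D'
        exact D.isDiagonalAlong_of_fold hyx (ih _ (by simp only [List.length_cons]; omega) D'.drop_top_zero rfl)
      · have D' := D.fold hyx
        rw [show 2 * y - x = 0 by omega] at D'
        exact D.isDiagonalAlong_of_fold hyx
          (isDiagonalAlong_of_swap (ih _ (by simp only [List.length_cons]; omega) D'.swap.drop_top_zero rfl))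
    match a, b, D, ih with
    | [], _, D, _ => exact D.isDiagonalAlong_of_sum_eq_zero (by simpa using D.sum_top.symm)
    | _, [], D, _ => exact D.isDiagonalAlong_of_sum_eq_zero (by simpa using D.sum_bottom.symm)
    | x :: a, y :: b, D, ih =>
      rcases Nat.eq_zero_or_pos x with rfl | hx
      · exact ih _ (by simp only [List.length_cons]; omega) D.drop_top_zero rfl
      rcases Nat.eq_zero_or_pos y with rfl | hy
      · exact isDiagonalAlong_of_swap (ih _ (by simp only [List.length_cons]; omega) D.swap.drop_top_zero rfl)
      rcases lt_trichotomy y x with hyx | rfl | hxy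
      · exact step D hy hyx fun m hm {_ _ _ _ _} D h => ih m hm D h
      · obtain rfl := D.block_eq_one hy
        have hs := D.sum_top
        rw [List.sum_cons] at hs
        exact D.isDiagonalAlong_of_tail (ih _ (by simp only [List.length_cons]; omega) D.tail rfl)
      · exact isDiagonalAlong_of_swap
          (step D.swap hx hxy fun m hm {_ _ _ _ _} D h => ih m (by omega) D h)

end KernelData

/-! ### Gradings and tail-free components from the homotopy type -/

/-- The meander of `a` and `b` on `n` vertices has a grading (hence no cycle) and no vertex beyond
both compositions, and the entries of `I` represent exactly the components that do not meet the
tail; this is expressed by functions that are constant along the arcs. -/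
structure MeanderData (n : ℕ) (a b I : List ℕ) : Prop where
  grading : ∃ g : ℕ → ℤ, IsGraded 2 a b g ∧
    ∀ i < n, (b.sum ≤ i → g i = -1) ∧ (a.sum ≤ i → g i = 1)
  point : ∀ i ∈ I, i < n ∧ IsEndpoint a b i ∧
    ∃ f : ℕ → ℂ, IsGraded 0 a b f ∧ f i ≠ 0 ∧ ∀ j < n, InTail a b j → f j = 0
  determined : ∀ f : ℕ → ℂ, IsGraded 0 a b f → (∀ j < n, InTail a b j → f j = 0) →
    (∀ i ∈ I, f i = 0) → ∀ i < n, f i = 0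

namespace MeanderData

variable {n : ℕ} {a b I : List ℕ}

theorem swap (D : MeanderData n a b I) : MeanderData n b a I := by
  have tail : ∀ j, InTail a b j ↔ InTail b a j := fun j => by rw [InTail, InTail, xor_comm]
  refine ⟨?_, fun i hi => ?_, fun f hf ht hI => ?_⟩
  · obtain ⟨g, hg, h⟩ := D.grading
    refine ⟨_, hg.swap, fun i hi => ⟨fun h' => ?_, fun h' => ?_⟩⟩
    · simp only [(h i hi).2 h']
    · simp only [(h i hi).1 h', neg_neg]
  · obtain ⟨h₁, h₂, f, hf, h₃, h₄⟩ := D.point i hi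
    refine ⟨h₁, by rwa [IsEndpoint, and_comm], _, by simpa using hf.swap, neg_ne_zero.2 h₃,
      fun j hj hj' => ?_⟩
    rw [h₄ j hj ((tail j).2 hj'), neg_zero]
  · intro i hi
    have h := D.determined _ (by simpa using hf.swap)
      (fun j hj hj' => by rw [ht j hj ((tail j).1 hj'), neg_zero])
      (fun i hi => by rw [hI i hi, neg_zero]) i hi
    exact neg_eq_zero.1 h

theorem zero_cons_top (D : MeanderData n a b I) : MeanderData n (0 :: a) b I := by
  obtain ⟨h₁, h₂, h₃⟩ := D
  refine ⟨?_, ?_, ?_⟩ <;>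
    simpa only [IsGraded, DirectedArc, IsEndpoint, InTail, arc_zero_cons, List.sum_cons, zero_add]

/-- An endpoint of the component of the vertex `i + m` before winding down, if `i` is an endpoint
after winding down. -/
def unwindPoint (x y m i : ℕ) : ℕ :=
  if i + m < y ∨ 2 * (i + m) + 1 + y = 2 * x then x - 1 - (i + m) else i + m

/-- An index i + m < y stands for its mirror image. The centre of the reflected block, where 2(i +
m) + 1 + y = 2x, is the image of the centre of the old bottom block, and it is that centre which
lacks a bottom arc. In all other cases the vertex itself remains an endpoint. -/
theorem isEndpoint_unwindPoint {x y m i : ℕ} (hyx : y < x) (hm : m = min y (x - y))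
    (h : IsEndpoint ((x - 2 * y) :: y :: a) ((2 * y - x) :: b) i) :
    IsEndpoint (x :: a) (y :: b) (unwindPoint x y m i) := by
  intro ⟨⟨j, hj⟩, k, hk⟩
  apply h
  have top : ∀ q, m ≤ q → _ → ∃ j, Arc ((x - 2 * y) :: y :: a) i j := fun q hq h =>
    ⟨q - m, by simpa using (arc_top_move (p := i + m) hyx hm (by omega) hq).2 h⟩
  have bot : ∀ q, m ≤ q → _ → ∃ j, Arc ((2 * y - x) :: b) i j := fun q hq h =>
    ⟨q - m, by simpa using (arc_bottom_move (p := i + m) hyx hm (by omega) hq).2 h⟩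
  unfold unwindPoint at hj hk
  split_ifs at hj hk with hc
  · rcases hc with hc | hc
    · refine ⟨top (2 * x - 1 - y - (i + m)) (by omega)
        (Or.inl ⟨?_, Or.inr ⟨by omega, by omega, by omega, by omega, by omega⟩⟩),
        bot (x - 1 - (i + m)) (by omega) (Or.inl ?_)⟩
      · rcases hk with hk | hk <;> omega
      · rcases hj with hj | hj <;> omega
    · rcases hk with hk | hk <;> omega
  · refine ⟨?_, ?_⟩
    · rcases hj with hj | hj
      · by_cases hi : i + m < x - y
        · exact top j (by omega) (Or.inl ⟨hj.2.2.1, Or.inl (by omega)⟩)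
        · exact top (2 * x - 1 - y - (i + m)) (by omega)
            (Or.inl ⟨by omega, Or.inr ⟨by omega, by omega, by omega, by omega, by omega⟩⟩)
      · exact top j (by omega) (Or.inr hj)
    · rcases hk with hk | hk
      · omega
      · exact bot k (by omega) (Or.inr hk)

/-- A move only shortens components along top arcs of the first block and leaves the tail unchanged.
So functions constant along arcs before and after it correspond. -/
theorem unwind {x y : ℕ} (hyx : y < x) (ha : (x :: a).sum ≤ n) (hb : (y :: b).sum ≤ n)
    (D : MeanderData (n - min y (x - y)) ((x - 2 * y) :: y :: a) ((2 * y - x) :: b) I) :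
    ∃ J : List ℕ, J.length = I.length ∧ MeanderData n (x :: a) (y :: b) J := by
  obtain ⟨m, hm⟩ : ∃ m, m = min y (x - y) := ⟨_, rfl⟩
  rw [← hm] at D
  rw [List.sum_cons] at ha hb
  have sa : ∀ p, m ≤ p → (((x - 2 * y) :: y :: a).sum ≤ p - m ↔ (x :: a).sum ≤ p) := by
    intro p hp
    simp only [List.sum_cons]
    omega
  have sb : ∀ p, m ≤ p → (((2 * y - x) :: b).sum ≤ p - m ↔ (y :: b).sum ≤ p) := by
    intro p hp
    simp only [List.sum_cons]
    omega
  have tail : ∀ p, m ≤ p → (InTail ((x - 2 * y) :: y :: a) ((2 * y - x) :: b) (p - m) ↔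
      InTail (x :: a) (y :: b) p) := by
    intro p hp
    rw [InTail, InTail, sa p hp, sb p hp]
  have tail_le : ∀ p, InTail (x :: a) (y :: b) p → y ≤ p := by
    rintro p (h | h) <;> simp only [List.sum_cons] at h <;> omega
  have eq_mirror : ∀ {f : ℕ → ℂ}, IsGraded 0 (x :: a) (y :: b) f → ∀ p, y ≤ p → x - y ≤ p → p < x →
      f (x - 1 - p) = f p := by
    intro f hf p hp hp' hpx
    rw [hf p (x - 1 - p) (Or.inl ⟨by omega, Or.inl ⟨hpx, by omega, by omega, by omega⟩⟩), add_zero]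
  refine ⟨I.map (unwindPoint x y m), by simp, ?_, ?_, ?_⟩
  · obtain ⟨g, hg, h⟩ := D.grading
    refine ⟨_, hg.unwind hyx hm, fun p hp => ⟨fun h' => ?_, fun h' => ?_⟩⟩
    · have hyp : y ≤ p := by
        rw [List.sum_cons] at h'
        omega
      simp only [if_pos hyp]
      exact (h (p - m) (by omega)).1 ((sb p (by omega)).2 h')
    · have hyp : y ≤ p := by
        rw [List.sum_cons] at h'
        omega
      simp only [if_pos hyp]
      exact (h (p - m) (by omega)).2 ((sa p (by omega)).2 h')
  · intro p hp
    obtain ⟨i, hi, rfl⟩ := List.mem_map.1 hp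
    obtain ⟨h₁, h₂, f, hf, h₃, h₄⟩ := D.point i hi
    refine ⟨?_, isEndpoint_unwindPoint hyx hm h₂, _, hf.unwind hyx hm, ?_, ?_⟩
    · unfold unwindPoint
      split_ifs <;> omega
    · unfold unwindPoint
      simp only [add_zero]
      split_ifs with h₅ h₆ h₆
      · rwa [show x - 1 - (i + m) - m = i by omega]
      · rwa [show x - 1 - (x - 1 - (i + m)) - m = i by omega]
      · rwa [Nat.add_sub_cancel]
      · omega
    · intro p hp hpt
      have := tail_le p hpt
      simp only [if_pos this]
      exact h₄ _ (by omega) ((tail p (by omega)).2 hpt)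
  · intro f hf ht hI
    have h := D.determined _ (hf.wind hyx hm) ?_ ?_
    · intro p hp
      by_cases hpy : y ≤ p
      · have := h (p - m) (by omega)
        simpa only [show p - m + m = p by omega, if_pos hpy] using this
      · have h₁ := h (x - 1 - p - m) (by omega)
        simp only [show x - 1 - p - m + m = x - 1 - p by omega, sub_zero] at h₁
        split_ifs at h₁ with h₂
        · rw [← eq_mirror hf _ h₂ (by omega) (by omega)] at h₁
          rwa [show x - 1 - (x - 1 - p) = p by omega] at h₁
        · rwa [show x - 1 - (x - 1 - p) = p by omega] at h₁
    · intro j hj hjt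
      have h₁ := (tail (j + m) (by omega)).1 (by simpa using hjt)
      rw [if_pos (tail_le _ h₁)]
      exact ht _ (by omega) h₁
    · intro i hi
      have h₁ := hI _ (List.mem_map_of_mem hi)
      unfold unwindPoint at h₁
      simp only [sub_zero]
      by_cases h₃ : y ≤ i + m
      · rw [if_pos h₃]
        split_ifs at h₁ with h₂
        · rw [← eq_mirror hf _ h₃ (by omega) (by omega), h₁]
        · exact h₁
      · rw [if_pos (by omega)] at h₁
        rw [if_neg h₃, h₁]

theorem delete_component (D : MeanderData (n - 1) a b I) (ha : (1 :: a).sum ≤ n) :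
    MeanderData n (1 :: a) (1 :: b) (0 :: I.map (· + 1)) := by
  rw [List.sum_cons] at ha
  have arc : ∀ (c : List ℕ) i j, Arc (1 :: c) (i + 1) (j + 1) ↔ Arc c i j := by
    intro c i j
    simp [Arc]
  have arc₀ : ∀ (c : List ℕ) i, ¬ Arc (1 :: c) 0 i := by
    intro c i
    simp only [Arc]
    omega
  have dir : ∀ i j, DirectedArc (1 :: a) (1 :: b) (i + 1) (j + 1) ↔ DirectedArc a b i j := by
    intro i j
    simp [DirectedArc, arc]
  have dir₀ : ∀ i j, DirectedArc (1 :: a) (1 :: b) i j →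
      ∃ k l, i = k + 1 ∧ j = l + 1 ∧ DirectedArc a b k l := by
    intro i j h
    rcases i with _ | i
    · rcases h with h | h
      · exact (arc₀ _ _ h.2).elim
      · exact (arc₀ _ _ h.2).elim
    rcases j with _ | j
    · rcases h with h | h
      · exact (arc₀ _ _ h.2.symm).elim
      · exact (arc₀ _ _ h.2.symm).elim
    exact ⟨i, j, rfl, rfl, (dir i j).1 h⟩
  have ext : ∀ {R : Type} [AddCommGroup R] {d : R} (c : R) {f : ℕ → R}, IsGraded d a b f →
      IsGraded d (1 :: a) (1 :: b) (fun i => if i = 0 then c else f (i - 1)) := by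
    intro R _ d c f hf i j h
    obtain ⟨k, l, rfl, rfl, h'⟩ := dir₀ i j h
    simpa using hf k l h'
  have tail : ∀ i, InTail (1 :: a) (1 :: b) (i + 1) ↔ InTail a b i := by
    intro i
    simp [InTail, add_comm 1]
  have tail₀ : ¬ InTail (1 :: a) (1 :: b) 0 := by
    simp [InTail]
  refine ⟨?_, ?_, ?_⟩
  · obtain ⟨g, hg, h⟩ := D.grading
    refine ⟨_, ext 0 hg, fun i hi => ?_⟩
    rcases i with _ | i
    · simp
    · simpa [add_comm 1] using h i (by omega)
  · intro p hp
    rcases List.mem_cons.1 hp with rfl | hp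
    · refine ⟨by omega, fun h => ?_, fun i => if i = 0 then 1 else 0, ?_, by simp, ?_⟩
      · obtain ⟨j, hj⟩ := h.1
        exact arc₀ _ _ hj
      · exact ext (f := fun _ => 0) 1 fun i j _ => by simp
      · intro j hj ht
        rcases j with _ | j
        · exact (tail₀ ht).elim
        · simp
    · obtain ⟨i, hi, rfl⟩ := List.mem_map.1 hp
      obtain ⟨h₁, h₂, f, hf, h₃, h₄⟩ := D.point i hi
      refine ⟨by omega, ?_, _, ext 0 hf, by simpa using h₃, ?_⟩
      · rintro ⟨⟨j, hj⟩, k, hk⟩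
        rcases j with _ | j
        · exact arc₀ _ _ hj.symm
        rcases k with _ | k
        · exact arc₀ _ _ hk.symm
        exact h₂ ⟨⟨j, (arc _ _ _).1 hj⟩, k, (arc _ _ _).1 hk⟩
      · intro j hj ht
        rcases j with _ | j
        · simp
        · simpa using h₄ j (by omega) ((tail j).1 ht)
  · intro f hf ht hI i hi
    rcases i with _ | i
    · exact hI 0 (by simp)
    · refine D.determined (fun i => f (i + 1)) (fun i j h => hf _ _ ((dir i j).2 h))
        (fun j hj hjt => ht _ (by omega) ((tail j).2 hjt)) (fun i hi => hI _ ?_) i (by omega)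
      exact List.mem_cons_of_mem _ (List.mem_map_of_mem hi)

/-- There are no arcs, and as n ≤ s every vertex is in the tail. Hence no component avoids the tail,
and the constant -1 is a grading. -/
theorem replicate_one {s : ℕ} (h : n ≤ s) : MeanderData n (List.replicate s 1) [] [] := by
  have arc : ∀ i j, ¬ Arc (List.replicate s 1) i j := by
    clear h
    induction s with
    | zero => exact fun i j h => h
    | succ s ih =>
      intro i j h
      rcases h with h | h
      · omega
      · exact ih _ _ h.2.2
  have dir : ∀ i j, ¬ DirectedArc (List.replicate s 1) [] i j := by
    rintro i j (h | h)
    · exact arc _ _ h.2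
    · exact h.2
  refine ⟨⟨fun _ => -1, fun i j h => (dir i j h).elim, fun i hi => ⟨fun _ => rfl, fun h' => ?_⟩⟩,
    by simp, fun f _ ht _ i hi => ht i hi (Or.inr ⟨by simp, ?_⟩)⟩
  · simp only [List.sum_replicate, smul_eq_mul, mul_one] at h'
    omega
  · simp only [List.sum_replicate, smul_eq_mul, mul_one]
    omega

end MeanderData

theorem WindsDown.meanderData {n k s : ℕ} {a b cs r : List ℕ} (w : WindsDown n a b cs k r)
    (hr : r = List.replicate s 1) (hk : k ≤ s) (hcs : ∀ c ∈ cs, c = 1) (ha : a.sum ≤ n)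
    (hb : b.sum ≤ n) : ∃ I : List ℕ, I.length = cs.length ∧ MeanderData n a b I := by
  induction w with
  | done_bottom n a => exact ⟨[], rfl, hr ▸ MeanderData.replicate_one hk⟩
  | done_top n b => exact ⟨[], rfl, hr ▸ (MeanderData.replicate_one hk).swap⟩
  | pure_contraction n x y a b cs k r h w ih =>
    have ha' := ha
    have hb' := hb
    rw [List.sum_cons] at ha' hb'
    obtain ⟨I, hI, D⟩ := ih hr hk hcs (by simp only [List.sum_cons]; omega) (by omega)
    -- A zero bottom block brings the move into the uniform shape that `MeanderData.unwind` expects.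
    have D' := D.swap.zero_cons_top.swap
    rw [show n - y = n - min y (x - y) by omega] at D'
    obtain ⟨J, hJ, D''⟩ := MeanderData.unwind (by omega) ha hb
      (by rwa [show 2 * y - x = 0 by omega])
    exact ⟨J, hJ.trans hI, D''⟩
  | block_elimination n x y a b cs k r h w ih =>
    have ha' := ha
    have hb' := hb
    rw [List.sum_cons] at ha' hb'
    obtain ⟨I, hI, D⟩ := ih hr hk hcs (by simp only [List.sum_cons]; omega) (by omega)
    -- Blocks need not be positive here, and for x = y = 0 there is nothing to unwind.
    rcases Nat.eq_zero_or_pos y with rfl | hy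
    · obtain rfl : x = 0 := h
      exact ⟨I, hI, D.swap.zero_cons_top.swap⟩
    have D' := D.zero_cons_top.swap.zero_cons_top.swap
    rw [show n - y = n - min y (x - y) by omega] at D'
    obtain ⟨J, hJ, D''⟩ := MeanderData.unwind (by omega) ha hb
      (by rwa [show 2 * y - x = 0 by omega, show x - 2 * y = 0 by omega])
    exact ⟨J, hJ.trans hI, D''⟩
  | rotation_contraction n x y a b cs k r h₁ h₂ w ih =>
    have ha' := ha
    have hb' := hb
    rw [List.sum_cons] at ha' hb'
    obtain ⟨I, hI, D⟩ := ih hr hk hcs (by simp only [List.sum_cons]; omega)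
      (by simp only [List.sum_cons]; omega)
    have D' := D.zero_cons_top
    rw [show n - (x - y) = n - min y (x - y) by omega] at D'
    obtain ⟨J, hJ, D''⟩ := MeanderData.unwind h₁ ha hb
      (by rwa [show x - 2 * y = 0 by omega])
    exact ⟨J, hJ.trans hI, D''⟩
  | component_deletion n c a b cs k r w ih =>
    have ha' := ha
    have hb' := hb
    rw [List.sum_cons] at ha' hb'
    obtain rfl : c = 1 := hcs c (by simp)
    obtain ⟨I, hI, D⟩ := ih hr hk (fun c hc => hcs c (List.mem_cons_of_mem _ hc)) (by omega)
      (by omega)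
    exact ⟨_, by simp [hI], D.delete_component ha⟩
  | flip n x y a b cs k r h w ih =>
    obtain ⟨I, hI, D⟩ := ih hr hk hcs hb ha
    exact ⟨I, hI, D.swap⟩

/-! ### The symmetry of the full meander -/

theorem arc_append {c d : List ℕ} {i j : ℕ} :
    Arc (c ++ d) i j ↔
      Arc c i j ∨ (c.sum ≤ i ∧ c.sum ≤ j ∧ Arc d (i - c.sum) (j - c.sum)) := by
  induction c generalizing i j with
  | nil => simp [Arc]
  | cons x c ih =>
    simp only [List.cons_append, Arc, ih, List.sum_cons, Nat.sub_sub]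
    constructor
    · rintro (h | ⟨h₁, h₂, h | ⟨h₃, h₄, h₅⟩⟩)
      · exact Or.inl (Or.inl h)
      · exact Or.inl (Or.inr ⟨h₁, h₂, h⟩)
      · exact Or.inr ⟨by omega, by omega, h₅⟩
    · rintro ((h | ⟨h₁, h₂, h⟩) | ⟨h₃, h₄, h₅⟩)
      · exact Or.inl h
      · exact Or.inr ⟨h₁, h₂, Or.inl h⟩
      · exact Or.inr ⟨by omega, by omega, Or.inr ⟨by omega, by omega, h₅⟩⟩

theorem sameBlock_append {c d : List ℕ} {i j : ℕ} :
    SameBlock (c ++ d) i j ↔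
      SameBlock c i j ∨ (c.sum ≤ i ∧ c.sum ≤ j ∧ SameBlock d (i - c.sum) (j - c.sum)) := by
  induction c generalizing i j with
  | nil => simp [SameBlock]
  | cons x c ih =>
    simp only [List.cons_append, SameBlock, ih, List.sum_cons, Nat.sub_sub]
    constructor
    · rintro (h | ⟨h₁, h₂, h | ⟨h₃, h₄, h₅⟩⟩)
      · exact Or.inl (Or.inl h)
      · exact Or.inl (Or.inr ⟨h₁, h₂, h⟩)
      · exact Or.inr ⟨by omega, by omega, h₅⟩
    · rintro ((h | ⟨h₁, h₂, h⟩) | ⟨h₃, h₄, h₅⟩)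
      · exact Or.inl h
      · exact Or.inr ⟨h₁, h₂, Or.inl h⟩
      · exact Or.inr ⟨by omega, by omega, Or.inr ⟨by omega, by omega, h₅⟩⟩

theorem Arc.reverse {c : List ℕ} {i j : ℕ} (h : Arc c i j) :
    Arc c.reverse (c.sum - 1 - i) (c.sum - 1 - j) := by
  induction c generalizing i j with
  | nil => exact h
  | cons x c ih =>
    rw [List.reverse_cons, arc_append, List.sum_reverse, List.sum_cons]
    rcases h with h | ⟨h₁, h₂, h₃⟩
    · exact Or.inr ⟨by omega, by omega, Or.inl ⟨by omega, by omega, by omega, by omega⟩⟩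
    · left
      have := ih h₃
      have l₁ := h₃.lt_sum
      have l₂ := h₃.symm.lt_sum
      rwa [show x + c.sum - 1 - i = c.sum - 1 - (i - x) by omega,
        show x + c.sum - 1 - j = c.sum - 1 - (j - x) by omega]

theorem SameBlock.reverse {c : List ℕ} {i j : ℕ} (h : SameBlock c i j) :
    SameBlock c.reverse (c.sum - 1 - i) (c.sum - 1 - j) := by
  induction c generalizing i j with
  | nil => exact h
  | cons x c ih =>
    rw [List.reverse_cons, sameBlock_append, List.sum_reverse, List.sum_cons]
    rcases h with h | ⟨h₁, h₂, h₃⟩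
    · exact Or.inr ⟨by omega, by omega, Or.inl ⟨by omega, by omega⟩⟩
    · left
      have := ih h₃
      have l₁ := h₃.lt_sum
      have l₂ := h₃.symm.lt_sum
      rwa [show x + c.sum - 1 - i = c.sum - 1 - (i - x) by omega,
        show x + c.sum - 1 - j = c.sum - 1 - (j - x) by omega]

theorem sameBlock_self {c : List ℕ} {i : ℕ} (h : i < c.sum) : SameBlock c i i := by
  induction c generalizing i with
  | nil => simp at h
  | cons x c ih =>
    rw [List.sum_cons] at h
    rcases lt_or_ge i x with h' | h'
    · exact Or.inl ⟨h', h'⟩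
    · exact Or.inr ⟨h', h', ih (by omega)⟩

section Full

variable {n : ℕ} {c : List ℕ}

theorem sum_fullComposition (hc : c.sum ≤ n) : (fullComposition n c).sum = 2 * n := by
  simp only [fullComposition, List.sum_append, List.sum_cons, List.sum_reverse]
  omega

theorem reverse_fullComposition : (fullComposition n c).reverse = fullComposition n c := by
  simp [fullComposition]

theorem Arc.full_rev (hc : c.sum ≤ n) {i j : ℕ} (h : Arc (fullComposition n c) i j) :
    Arc (fullComposition n c) (2 * n - 1 - i) (2 * n - 1 - j) := by
  simpa only [reverse_fullComposition, sum_fullComposition hc] using h.reverse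

theorem SameBlock.full_rev (hc : c.sum ≤ n) {i j : ℕ} (h : SameBlock (fullComposition n c) i j) :
    SameBlock (fullComposition n c) (2 * n - 1 - i) (2 * n - 1 - j) := by
  simpa only [reverse_fullComposition, sum_fullComposition hc] using h.reverse

theorem Arc.full {i j : ℕ} (h : Arc c i j) : Arc (fullComposition n c) i j :=
  arc_append.2 (Or.inl h)

theorem arc_full_mid {i : ℕ} (hi : c.sum ≤ i) (hin : i < n) :
    Arc (fullComposition n c) i (2 * n - 1 - i) :=
  arc_append.2 (Or.inr ⟨hi, by omega, Or.inl ⟨by omega, by omega, by omega, by omega⟩⟩)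

theorem Arc.of_full (hc : c.sum ≤ n) {i j : ℕ} (hi : i < n)
    (h : Arc (fullComposition n c) i j) :
    (j < n ∧ Arc c i j) ∨ (c.sum ≤ i ∧ i + j + 1 = 2 * n) := by
  rcases arc_append.1 h with h | ⟨h₁, h₂, h | h⟩
  · have := h.symm.lt_sum
    exact Or.inl ⟨by omega, h⟩
  · omega
  · omega

/-- A graded function extends to the full meander as an odd function, if the arcs of the middle
blocks allow it. -/
theorem IsGraded.full {R : Type*} [AddCommGroup R] {d : R} {a b : List ℕ} (ha : a.sum ≤ n)
    (hb : b.sum ≤ n) {f : ℕ → R} (hf : IsGraded d a b f)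
    (ht : ∀ i < n, a.sum ≤ i → f i = -f i + d) (hu : ∀ i < n, b.sum ≤ i → -f i = f i + d) :
    IsGraded d (fullComposition n a) (fullComposition n b)
      (fun i => if i < n then f i else -f (2 * n - 1 - i)) := by
  have hlt : ∀ {c : List ℕ} {i j : ℕ}, c.sum ≤ n → Arc (fullComposition n c) i j →
      i < 2 * n ∧ j < 2 * n := by
    intro c i j hc h
    rw [← sum_fullComposition hc]
    exact ⟨h.lt_sum, h.symm.lt_sum⟩
  -- Reflection preserves the blocks and reverses every directed arc; negating f compensates for
  -- this.
  have neg : ∀ p q, f q = f p + d → -f p = -f q + d := by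
    intro p q h
    rw [h]
    abel
  rintro i j (⟨h₀, h⟩ | ⟨h₀, h⟩)
  · have hl := hlt ha h
    simp only
    by_cases hi : i < n
    · rw [if_pos hi, if_pos (by omega)]
      rcases h.of_full ha hi with h₁ | h₁
      · exact hf _ _ (Or.inl ⟨h₀, h₁.2⟩)
      · omega
    · rw [if_neg hi]
      by_cases hj : j < n
      · rw [if_pos hj]
        rcases h.symm.of_full ha hj with h₁ | h₁
        · omega
        · rw [show 2 * n - 1 - i = j by omega]
          exact ht j hj h₁.1
      · rw [if_neg hj]
        rcases (h.full_rev ha).of_full ha (by omega) with h₁ | h₁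
        · exact neg _ _ (hf _ _ (Or.inl ⟨by omega, h₁.2.symm⟩))
        · omega
  · have hl := hlt hb h
    simp only
    by_cases hj : j < n
    · rw [if_pos hj, if_pos (by omega)]
      rcases h.symm.of_full hb hj with h₁ | h₁
      · exact hf _ _ (Or.inr ⟨h₀, h₁.2.symm⟩)
      · omega
    · rw [if_neg hj]
      by_cases hi : i < n
      · rw [if_pos hi]
        rcases h.of_full hb hi with h₁ | h₁
        · omega
        · rw [show 2 * n - 1 - j = i by omega]
          exact hu i hi h₁.1
      · rw [if_neg hi]
        rcases (h.full_rev hb).of_full hb (by omega) with h₁ | h₁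
        · exact neg _ _ (hf _ _ (Or.inr ⟨by omega, h₁.2.symm⟩))
        · omega

end Full

/-! ### The unique tail-free path -/

section Components

variable {n : ℕ} {a b : List ℕ}

theorem InTail.isEndpoint {i : ℕ} (h : InTail a b i) : IsEndpoint a b i := by
  rintro ⟨⟨j, hj⟩, k, hk⟩
  have := hj.lt_sum
  have := hk.lt_sum
  rcases h with h | h <;> omega

theorem IsGraded.eq_of_arc {f : ℕ → ℂ} (hf : IsGraded 0 a b f) {i j : ℕ}
    (h : Arc a i j ∨ Arc b i j) : f i = f j := by
  rcases h with h | h <;> rcases lt_or_gt_of_ne h.ne with h' | h'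
  · rw [hf j i (Or.inl ⟨h', h.symm⟩), add_zero]
  · rw [hf i j (Or.inl ⟨h', h⟩), add_zero]
  · rw [hf i j (Or.inr ⟨h', h⟩), add_zero]
  · rw [hf j i (Or.inr ⟨h', h.symm⟩), add_zero]

theorem IsGraded.eq_of_reachable {f : ℕ → ℂ} (hf : IsGraded 0 a b f) {i j : Fin n}
    (h : (meander n a b).Reachable i j) : f i = f j := by
  obtain ⟨w⟩ := h
  induction w with
  | nil => rfl
  | cons h _ ih => exact (hf.eq_of_arc h).trans ih

open Classical in
/-- The indicator function of a set of vertices. -/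
noncomputable def vertexIndicator (V : Set (Fin n)) (i : ℕ) : ℂ :=
  if ∃ h : i < n, (⟨i, h⟩ : Fin n) ∈ V then 1 else 0

theorem vertexIndicator_of_mem {V : Set (Fin n)} {i : Fin n} (h : i ∈ V) :
    vertexIndicator V i = 1 :=
  if_pos ⟨i.2, h⟩

theorem vertexIndicator_of_notMem {V : Set (Fin n)} {i : Fin n} (h : i ∉ V) :
    vertexIndicator V i = 0 :=
  if_neg fun ⟨_, h'⟩ => h h'

theorem isGraded_vertexIndicator (ha : a.sum ≤ n) (hb : b.sum ≤ n)
    (P : (meander n a b).ConnectedComponent) : IsGraded 0 a b (vertexIndicator P.supp) := by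
  intro i j h
  have key : i < n ∧ j < n ∧ (Arc a i j ∨ Arc b i j) := by
    rcases h with ⟨_, h⟩ | ⟨_, h⟩
    · exact ⟨h.lt_sum.trans_le ha, h.symm.lt_sum.trans_le ha, Or.inl h⟩
    · exact ⟨h.lt_sum.trans_le hb, h.symm.lt_sum.trans_le hb, Or.inr h⟩
  obtain ⟨hi, hj, h'⟩ := key
  have adj : (meander n a b).Adj ⟨i, hi⟩ ⟨j, hj⟩ := h'
  have mem : (⟨i, hi⟩ : Fin n) ∈ P.supp ↔ (⟨j, hj⟩ : Fin n) ∈ P.supp := by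
    rw [SimpleGraph.ConnectedComponent.mem_supp_iff, SimpleGraph.ConnectedComponent.mem_supp_iff,
      SimpleGraph.ConnectedComponent.sound adj.reachable]
  rw [add_zero]
  by_cases hm : (⟨i, hi⟩ : Fin n) ∈ P.supp
  · exact (vertexIndicator_of_mem (mem.1 hm)).trans (vertexIndicator_of_mem hm).symm
  · exact (vertexIndicator_of_notMem (fun h => hm (mem.2 h))).trans
      (vertexIndicator_of_notMem hm).symm

theorem IsTailFreePath.indicator_tail {P : (meander n a b).ConnectedComponent}
    (hP : IsTailFreePath n a b P) (j : ℕ) (hj : j < n) (ht : InTail a b j) :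
    vertexIndicator P.supp j = 0 :=
  vertexIndicator_of_notMem (i := ⟨j, hj⟩) fun h => hP.2 _ h ht.isEndpoint ht

/-- Otherwise the indicator of P would be constant along arcs and zero both on the tail and at i₀,
hence zero everywhere. -/
theorem IsTailFreePath.mem_supp {i₀ : ℕ} (D : MeanderData n a b [i₀]) (ha : a.sum ≤ n)
    (hb : b.sum ≤ n) {P : (meander n a b).ConnectedComponent} (hP : IsTailFreePath n a b P)
    (hi₀ : i₀ < n) : (⟨i₀, hi₀⟩ : Fin n) ∈ P.supp := by
  by_contra h
  obtain ⟨i, hi, _⟩ := hP.1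
  have h₁ := D.determined _ (isGraded_vertexIndicator ha hb P) hP.indicator_tail
    (fun j hj => by
      rw [List.mem_singleton] at hj
      subst hj
      exact vertexIndicator_of_notMem h) i i.2
  rw [vertexIndicator_of_mem hi] at h₁
  exact one_ne_zero h₁

/-- The path is the component of i₀: the function supplied by `point` is a nonzero constant on it
but vanishes on the tail. -/
theorem MeanderData.existsUnique_isTailFreePath {i₀ : ℕ} (D : MeanderData n a b [i₀])
    (ha : a.sum ≤ n) (hb : b.sum ≤ n) :
    ∃! P : (meander n a b).ConnectedComponent, IsTailFreePath n a b P := by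
  obtain ⟨hi₀, he, f, hf, hf₀, ht⟩ := D.point i₀ (by simp)
  refine ⟨(meander n a b).connectedComponentMk ⟨i₀, hi₀⟩, ⟨⟨⟨i₀, hi₀⟩, rfl, he⟩, ?_⟩, ?_⟩
  · intro i hi _ hti
    have h := hf.eq_of_reachable (SimpleGraph.ConnectedComponent.exact hi)
    rw [ht i i.2 hti] at h
    exact hf₀ h.symm
  · intro P hP
    exact (hP.mem_supp D ha hb hi₀).symm

end Components

/-! ### The functional as an element of sp(2n) -/

variable {n : ℕ} {a b : List ℕ}

/-- The sign of an index, as in `mem_sp`. -/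
noncomputable def indexSign {n : ℕ} (i : Fin (2 * n)) : ℂ := if (i : ℕ) < n then 1 else -1

theorem indexSign_rev (i : Fin (2 * n)) : indexSign i.rev = -indexSign i := by
  have := i.2
  by_cases h : (i : ℕ) < n
  · rw [indexSign, indexSign, if_neg (by rw [Fin.val_rev]; omega), if_pos h]
  · rw [indexSign, indexSign, if_pos (by rw [Fin.val_rev]; omega), if_neg h, neg_neg]

theorem indexSign_mul_self (i : Fin (2 * n)) : indexSign i * indexSign i = 1 := by
  unfold indexSign
  split_ifs <;> ring

open Classical in
/-- The coefficient of `e_{p,q}^*` in `phiOne`. -/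
noncomputable def phiCoeff (n : ℕ) (a b : List ℕ) (V : Set (Fin n)) (p q : Fin (2 * n)) : ℂ :=
  (if p = q then vertexIndicator V p else 0) +
    if OrientedFullEdge n a b p q ∧ ((p : ℕ) < n ∨ (q : ℕ) < n) then 1 else 0

theorem vertexIndicator_of_le {V : Set (Fin n)} {i : ℕ} (h : n ≤ i) : vertexIndicator V i = 0 :=
  if_neg fun ⟨h', _⟩ => by omega

open Classical in
theorem sum_lift (V : Set (Fin n)) (f : Fin (2 * n) → ℂ) :
    ∑ i : Fin n with i ∈ V, f (lift i) = ∑ p : Fin (2 * n), vertexIndicator V p * f p := by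
  have h : ∀ p ∉ Finset.univ.map (Fin.castLEEmb (show n ≤ 2 * n by omega)),
      vertexIndicator V p * f p = 0 := by
    intro p hp
    have : n ≤ p := by
      by_contra h
      exact hp (Finset.mem_map.2 ⟨⟨p, by omega⟩, Finset.mem_univ _, rfl⟩)
    rw [vertexIndicator_of_le this, zero_mul]
  rw [← Finset.sum_subset (Finset.subset_univ _) fun p _ hp => h p hp, Finset.sum_map,
    Finset.sum_filter]
  refine Finset.sum_congr rfl fun i _ => ?_
  have e : vertexIndicator V ((Fin.castLEEmb (show n ≤ 2 * n by omega)) i : ℕ) =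
      vertexIndicator V (i : ℕ) := rfl
  rw [e]
  split_ifs with hi
  · rw [vertexIndicator_of_mem hi, one_mul]
    rfl
  · rw [vertexIndicator_of_notMem hi, zero_mul]

theorem phiOne_apply (V : Set (Fin n)) (Z : seaweed n a b) :
    phiOne n a b V Z =
      ∑ p, ∑ q, phiCoeff n a b V p q * (Z : Matrix (Fin (2 * n)) (Fin (2 * n)) ℂ) p q := by
  classical
  have h₁ : ∀ i j, coord n a b i j Z = (Z : Matrix (Fin (2 * n)) (Fin (2 * n)) ℂ) i j :=
    fun _ _ => rfl
  rw [phiOne, LinearMap.add_apply, LinearMap.sum_apply, LinearMap.sum_apply]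
  simp only [h₁]
  rw [sum_lift V fun p => (Z : Matrix (Fin (2 * n)) (Fin (2 * n)) ℂ) p p, Finset.sum_filter,
    Fintype.sum_prod_type, ← Finset.sum_add_distrib]
  refine Finset.sum_congr rfl fun p _ => ?_
  simp only [phiCoeff, add_mul, Finset.sum_add_distrib, ite_mul, zero_mul, one_mul,
    Finset.sum_ite_eq, Finset.mem_univ, if_true]

theorem hOne_apply (V : Set (Fin n)) (p q : Fin (2 * n)) :
    hOne n V p q = if p = q then
      (if (p : ℕ) < n then vertexIndicator V p else -vertexIndicator V (2 * n - 1 - p)) else 0 := by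
  classical
  have h₁ : hOne n V p q = ∑ i : Fin n with i ∈ V,
      (fun r : Fin (2 * n) => (if r = p ∧ r = q then (1 : ℂ) else 0) -
        if r.rev = p ∧ r.rev = q then (1 : ℂ) else 0) (lift i) := by
    rw [hOne, Matrix.sum_apply]
    exact Finset.sum_congr rfl fun i _ => by simp [Matrix.single_apply]
  refine h₁.trans ((sum_lift V fun r : Fin (2 * n) => (if r = p ∧ r = q then (1 : ℂ) else 0) -
    if r.rev = p ∧ r.rev = q then (1 : ℂ) else 0).trans ?_)
  by_cases hpq : p = q
  · subst hpq
    have h₂ : ∀ r : Fin (2 * n), r.rev = p ↔ r = p.rev := fun r => Fin.rev_eq_iff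
    simp only [and_self, h₂, mul_sub, Finset.sum_sub_distrib, mul_ite, mul_one, mul_zero,
      Finset.sum_ite_eq', Finset.mem_univ, if_true]
    have := p.2
    split_ifs with hp
    · rw [vertexIndicator_of_le (i := (p.rev : ℕ)) (by rw [Fin.val_rev]; omega), sub_zero]
    · rw [vertexIndicator_of_le (i := (p : ℕ)) (by omega), zero_sub, Fin.val_rev,
        show 2 * n - (p + 1 : ℕ) = 2 * n - 1 - p by omega]
  · rw [if_neg hpq]
    refine Finset.sum_eq_zero fun r _ => ?_
    rw [if_neg fun h => hpq (h.1.symm.trans h.2), if_neg fun h => hpq (h.1.symm.trans h.2),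
      sub_zero, mul_zero]

/-- The matrix in `sp(2n)` that represents twice the functional `phiOne` by the trace form. -/
noncomputable def phiMatrix (n : ℕ) (a b : List ℕ) (V : Set (Fin n)) :
    Matrix (Fin (2 * n)) (Fin (2 * n)) ℂ :=
  Matrix.of fun q p => phiCoeff n a b V p q -
    indexSign p * indexSign q * phiCoeff n a b V q.rev p.rev

theorem mem_sp' {X : Matrix (Fin (2 * n)) (Fin (2 * n)) ℂ} :
    X ∈ sp n ↔ ∀ i j, X i j = -indexSign i * indexSign j * X j.rev i.rev :=
  mem_sp n X

theorem phiMatrix_mem_sp (V : Set (Fin n)) : phiMatrix n a b V ∈ sp n := by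
  refine mem_sp'.2 fun q p => ?_
  simp only [phiMatrix, Matrix.of_apply, Fin.rev_rev, indexSign_rev]
  linear_combination (-(indexSign q * indexSign q) * phiCoeff n a b V p q) *
    indexSign_mul_self p - phiCoeff n a b V p q * indexSign_mul_self q

/-- Reversing both indices and using the symmetry of Z turns the second summand of `phiMatrix` into
a copy of the first, whence the factor 2. -/
theorem trace_phiMatrix_mul (V : Set (Fin n)) {Z : Matrix (Fin (2 * n)) (Fin (2 * n)) ℂ}
    (hZ : Z ∈ sp n) : (phiMatrix n a b V * Z).trace =
      2 * ∑ p, ∑ q, phiCoeff n a b V p q * Z p q := by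
  have h₁ : (phiMatrix n a b V * Z).trace = ∑ p, ∑ q, phiCoeff n a b V p q * Z p q -
      ∑ p, ∑ q, indexSign p * indexSign q * phiCoeff n a b V q.rev p.rev * Z p q := by
    rw [Matrix.trace, ← Finset.sum_sub_distrib]
    simp only [Matrix.diag_apply, Matrix.mul_apply]
    rw [Finset.sum_comm]
    refine Finset.sum_congr rfl fun p _ => ?_
    rw [← Finset.sum_sub_distrib]
    refine Finset.sum_congr rfl fun q _ => ?_
    rw [phiMatrix, Matrix.of_apply]
    ring
  have h₂ : ∑ p, ∑ q, indexSign p * indexSign q * phiCoeff n a b V q.rev p.rev * Z p q =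
      -∑ p, ∑ q, phiCoeff n a b V p q * Z p q := by
    rw [← Equiv.sum_comp Fin.revPerm, Finset.sum_congr rfl fun p _ =>
      (Equiv.sum_comp Fin.revPerm _).symm, Finset.sum_comm, ← Finset.sum_neg_distrib]
    refine Finset.sum_congr rfl fun p _ => ?_
    rw [← Finset.sum_neg_distrib]
    refine Finset.sum_congr rfl fun q _ => ?_
    rw [mem_sp'.1 hZ p q]
    simp only [Fin.revPerm_apply, Fin.rev_rev, indexSign_rev]
    ring
  rw [h₁, h₂]
  ring

theorem Admissible.rev (ha : a.sum ≤ n) (hb : b.sum ≤ n) {i j : Fin (2 * n)}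
    (h : Admissible n a b i j) : Admissible n a b j.rev i.rev := by
  have e : ∀ k : Fin (2 * n), (k.rev : ℕ) = 2 * n - 1 - k := fun k => by
    rw [Fin.val_rev]
    omega
  rcases h with ⟨h₁, h₂⟩ | ⟨h₁, h₂⟩
  · refine Or.inl ⟨Fin.rev_le_rev.2 h₁, ?_⟩
    rw [e, e]
    exact (h₂.full_rev ha).symm
  · refine Or.inr ⟨Fin.rev_le_rev.2 h₁, ?_⟩
    rw [e, e]
    exact (h₂.full_rev hb).symm

theorem OrientedFullEdge.rev (ha : a.sum ≤ n) (hb : b.sum ≤ n) {i j : Fin (2 * n)}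
    (h : OrientedFullEdge n a b i j) : OrientedFullEdge n a b j.rev i.rev := by
  have e : ∀ k : Fin (2 * n), (k.rev : ℕ) = 2 * n - 1 - k := fun k => by
    rw [Fin.val_rev]
    omega
  rcases h with ⟨h₁, h₂⟩ | ⟨h₁, h₂⟩
  · refine Or.inl ⟨Fin.rev_lt_rev.2 h₁, ?_⟩
    rw [e, e]
    exact (h₂.full_rev ha).symm
  · refine Or.inr ⟨Fin.rev_lt_rev.2 h₁, ?_⟩
    rw [e, e]
    exact (h₂.full_rev hb).symm

/-- An edge inside one half gets a contribution from only one of the two terms. An edge between the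
halves gets both, but there the sign product is -1, so they add up to 2. -/
theorem phiMatrix_ne_zero_iff (ha : a.sum ≤ n) (hb : b.sum ≤ n) (V : Set (Fin n))
    {i j : Fin (2 * n)} (hij : i ≠ j) :
    phiMatrix n a b V j i ≠ 0 ↔ OrientedFullEdge n a b i j := by
  have hr : j.rev ≠ i.rev := fun h => hij (Fin.rev_injective h).symm
  have hE : OrientedFullEdge n a b j.rev i.rev ↔ OrientedFullEdge n a b i j :=
    ⟨fun h => by simpa using h.rev ha hb, fun h => h.rev ha hb⟩
  rw [phiMatrix, Matrix.of_apply, phiCoeff, phiCoeff, if_neg hij, if_neg hr, hE, zero_add, zero_add,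
    Fin.val_rev, Fin.val_rev]
  have hi := i.2
  have hj := j.2
  by_cases h : OrientedFullEdge n a b i j
  · have e : (2 * n - (j + 1 : ℕ) < n ∨ 2 * n - (i + 1 : ℕ) < n) ↔
        (¬ (j : ℕ) < n ∨ ¬ (i : ℕ) < n) := by omega
    simp only [h, true_and, iff_true, indexSign, e]
    by_cases h₁ : (i : ℕ) < n <;> by_cases h₂ : (j : ℕ) < n <;> simp [h₁, h₂]
  · simp [h]

/-- Extension of a matrix by zero. -/
noncomputable def extendZero (X : Matrix (Fin (2 * n)) (Fin (2 * n)) ℂ) (i j : ℕ) : ℂ :=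
  if h : i < 2 * n ∧ j < 2 * n then X ⟨i, h.1⟩ ⟨j, h.2⟩ else 0

theorem extendZero_val (X : Matrix (Fin (2 * n)) (Fin (2 * n)) ℂ) (i j : Fin (2 * n)) :
    extendZero X i j = X i j :=
  dif_pos ⟨i.2, j.2⟩

theorem extendZero_of_ne_zero {X : Matrix (Fin (2 * n)) (Fin (2 * n)) ℂ} {i j : ℕ}
    (h : extendZero X i j ≠ 0) : i < 2 * n ∧ j < 2 * n := by
  by_contra h'
  exact h (dif_neg h')

theorem commEntry_extendZero (F X : Matrix (Fin (2 * n)) (Fin (2 * n)) ℂ) (j i : Fin (2 * n)) :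
    commEntry (2 * n) (extendZero F) (extendZero X) j i = ⁅F, X⁆ j i := by
  rw [commEntry, Finset.sum_range, Ring.lie_def, Matrix.sub_apply, Matrix.mul_apply,
    Matrix.mul_apply, ← Finset.sum_sub_distrib]
  simp only [extendZero_val]

theorem mem_seaweed {X : Matrix (Fin (2 * n)) (Fin (2 * n)) ℂ} :
    X ∈ seaweed n a b ↔ X ∈ sp n ∧ ∀ i j, ¬ Admissible n a b i j → X i j = 0 :=
  Iff.rfl

/-- The element `e_{i,j} ∓ e_{2n-j+1,2n-i+1}` of `sp(2n)`. -/
noncomputable def spRoot (i j : Fin (2 * n)) : Matrix (Fin (2 * n)) (Fin (2 * n)) ℂ :=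
  Matrix.single i j 1 - (indexSign i * indexSign j) • Matrix.single j.rev i.rev 1

theorem spRoot_mem (ha : a.sum ≤ n) (hb : b.sum ≤ n) {i j : Fin (2 * n)}
    (h : Admissible n a b i j) : spRoot i j ∈ seaweed n a b := by
  refine mem_seaweed.2 ⟨mem_sp'.2 fun p q => ?_, fun p q hpq => ?_⟩
  · have e₁ : (i = q.rev ∧ j = p.rev) ↔ (j.rev = p ∧ i.rev = q) := by
      rw [Fin.rev_eq_iff, Fin.rev_eq_iff, and_comm]
    have e₂ : (j.rev = q.rev ∧ i.rev = p.rev) ↔ (i = p ∧ j = q) := by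
      rw [Fin.rev_inj, Fin.rev_inj, and_comm]
    simp only [spRoot, Matrix.sub_apply, Matrix.smul_apply, Matrix.single_apply, smul_eq_mul, e₁, e₂]
    by_cases h₁ : i = p ∧ j = q
    · obtain ⟨rfl, rfl⟩ := h₁
      simp only [and_self, if_true]
      split_ifs
      · linear_combination (-(indexSign j * indexSign j)) * indexSign_mul_self i -
          indexSign_mul_self j
      · linear_combination (-(indexSign j * indexSign j)) * indexSign_mul_self i -
          indexSign_mul_self j
    · rw [if_neg h₁]
      by_cases h₂ : j.rev = p ∧ i.rev = q
      · obtain ⟨rfl, rfl⟩ := h₂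
        simp only [and_self, if_true, indexSign_rev]
        ring
      · rw [if_neg h₂]
        ring
  · have h₁ : ¬ (i = p ∧ j = q) := by
      rintro ⟨rfl, rfl⟩
      exact hpq h
    have h₂ : ¬ (j.rev = p ∧ i.rev = q) := by
      rintro ⟨rfl, rfl⟩
      exact hpq (h.rev ha hb)
    simp [spRoot, h₁, h₂]

theorem trace_mul_spRoot {M : Matrix (Fin (2 * n)) (Fin (2 * n)) ℂ} (hM : M ∈ sp n)
    (i j : Fin (2 * n)) : (M * spRoot i j).trace = 2 * M j i := by
  rw [spRoot, mul_sub, Matrix.trace_sub, Matrix.mul_smul, Matrix.trace_smul,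
    Matrix.trace_mul_single, Matrix.trace_mul_single, mem_sp'.1 hM j i]
  simp
  ring

theorem trace_mul_bracket {ι : Type*} [Fintype ι] [DecidableEq ι] (A B C : Matrix ι ι ℂ) :
    (A * ⁅B, C⁆).trace = (⁅A, B⁆ * C).trace := by
  rw [Ring.lie_def, Ring.lie_def, mul_sub, sub_mul, Matrix.trace_sub, Matrix.trace_sub,
    ← mul_assoc, ← mul_assoc, Matrix.trace_mul_cycle A C B]

/-- The commutator lies in sp(2n), where pairing with `spRoot i j` reads off twice a single entry.
This turns the type-C kernel condition into the type-A one. -/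
theorem commutator_eq_zero (ha : a.sum ≤ n) (hb : b.sum ≤ n) (V : Set (Fin n))
    {X : seaweed n a b} (hX : ∀ Y : seaweed n a b, phiOne n a b V ⁅X, Y⁆ = 0)
    {i j : Fin (2 * n)} (h : Admissible n a b i j) :
    ⁅phiMatrix n a b V, (X : Matrix (Fin (2 * n)) (Fin (2 * n)) ℂ)⁆ j i = 0 := by
  have h₁ := hX ⟨_, spRoot_mem ha hb h⟩
  rw [phiOne_apply] at h₁
  have h₂ := trace_phiMatrix_mul (a := a) (b := b) V
    (mem_seaweed.1 (⁅X, (⟨_, spRoot_mem ha hb h⟩ : seaweed n a b)⁆ : seaweed n a b).2).1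
  rw [h₁, mul_zero, LieSubalgebra.coe_bracket, trace_mul_bracket,
    trace_mul_spRoot ((sp n).lie_mem (phiMatrix_mem_sp V) (mem_seaweed.1 X.2).1)] at h₂
  simpa using h₂

theorem kernelData_extendZero (ha : a.sum ≤ n) (hb : b.sum ≤ n) (V : Set (Fin n))
    (hg : ∃ g : ℕ → ℤ, IsGraded 2 (fullComposition n a) (fullComposition n b) g)
    {X : seaweed n a b} (hX : ∀ Y : seaweed n a b, phiOne n a b V ⁅X, Y⁆ = 0) :
    KernelData (2 * n) (fullComposition n a) (fullComposition n b)
      (extendZero (phiMatrix n a b V)) (extendZero X.1) where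
  sum_top := sum_fullComposition ha
  sum_bottom := sum_fullComposition hb
  grading := hg
  spec i j hij := by
    constructor
    · intro h
      obtain ⟨hj, hi⟩ := extendZero_of_ne_zero h
      rw [extendZero_val _ ⟨j, hj⟩ ⟨i, hi⟩, phiMatrix_ne_zero_iff ha hb V (by simpa using hij)] at h
      exact h
    · intro h
      have hlt : i < 2 * n ∧ j < 2 * n := by
        rcases h with ⟨_, h⟩ | ⟨_, h⟩
        · exact ⟨sum_fullComposition ha ▸ h.lt_sum, sum_fullComposition ha ▸ h.symm.lt_sum⟩
        · exact ⟨sum_fullComposition hb ▸ h.lt_sum, sum_fullComposition hb ▸ h.symm.lt_sum⟩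
      rw [extendZero_val _ ⟨j, hlt.2⟩ ⟨i, hlt.1⟩,
        phiMatrix_ne_zero_iff ha hb V (by simpa using hij)]
      exact h
  supp i j h := by
    obtain ⟨hi, hj⟩ := extendZero_of_ne_zero h
    rw [extendZero_val _ ⟨i, hi⟩ ⟨j, hj⟩] at h
    by_contra h'
    exact h ((mem_seaweed.1 X.2).2 ⟨i, hi⟩ ⟨j, hj⟩ h')
  comm i j h := by
    obtain ⟨hi, hj⟩ := h.lt (sum_fullComposition ha) (sum_fullComposition hb)
    rw [commEntry_extendZero _ _ ⟨j, hj⟩ ⟨i, hi⟩]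
    exact commutator_eq_zero ha hb V hX (i := ⟨i, hi⟩) (j := ⟨j, hj⟩) h

/-! ### The kernel is spanned by the tail-free path -/

theorem MeanderData.inTail {I : List ℕ} (D : MeanderData n a b I) {i : ℕ} (hi : i < n)
    (h : a.sum ≤ i ∨ b.sum ≤ i) : InTail a b i := by
  obtain ⟨g, _, hg⟩ := D.grading
  have h₁ := hg i hi
  by_cases ha : a.sum ≤ i <;> by_cases hb : b.sum ≤ i
  · have := (h₁.1 hb).symm.trans (h₁.2 ha)
    omega
  · exact Or.inl ⟨ha, hb⟩
  · exact Or.inr ⟨hb, ha⟩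
  · tauto

/-- The values 1 and -1 on the tail are exactly what the middle arcs demand of an odd extension: g =
-g + 2 beyond the top blocks and -g = g + 2 beyond the bottom ones. This is why the step is 2. -/
theorem MeanderData.grading_full {I : List ℕ} (D : MeanderData n a b I) (ha : a.sum ≤ n)
    (hb : b.sum ≤ n) :
    ∃ g : ℕ → ℤ, IsGraded 2 (fullComposition n a) (fullComposition n b) g := by
  obtain ⟨g, hg, h⟩ := D.grading
  refine ⟨_, hg.full ha hb (fun i hi hai => ?_) fun i hi hbi => ?_⟩
  · rw [(h i hi).2 hai]
    norm_num
  · rw [(h i hi).1 hbi]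
    norm_num

theorem hOne_mem (ha : a.sum ≤ n) (V : Set (Fin n)) : hOne n V ∈ seaweed n a b := by
  refine mem_seaweed.2 ⟨mem_sp'.2 fun p q => ?_, fun p q hpq => ?_⟩
  · rw [hOne_apply, hOne_apply]
    by_cases h : p = q
    · subst h
      have hp := p.2
      have e : (p.rev : ℕ) = 2 * n - 1 - p := by
        rw [Fin.val_rev]
        omega
      rw [if_pos rfl, if_pos rfl, e, neg_mul, indexSign_mul_self,
        show 2 * n - 1 - (2 * n - 1 - (p : ℕ)) = p by omega]
      by_cases h₁ : (p : ℕ) < n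
      · rw [if_pos h₁, if_neg (by omega)]
        ring
      · rw [if_neg h₁, if_pos (by omega)]
        ring
    · rw [if_neg h, if_neg fun h' => h (Fin.rev_injective h').symm, mul_zero]
  · rw [hOne_apply, if_neg]
    rintro rfl
    exact hpq (Or.inl ⟨le_rfl, sameBlock_self (by rw [sum_fullComposition ha]; exact p.2)⟩)

/-- The odd extension of the indicator of P is constant along the full meander, including the middle
arcs, because it is zero on the tail. Bracketing with this diagonal matrix multiplies the entry at
an edge by a difference that is zero. -/
theorem phiOne_hOne_bracket {I : List ℕ} (D : MeanderData n a b I) (ha : a.sum ≤ n)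
    (hb : b.sum ≤ n) {P : (meander n a b).ConnectedComponent} (hP : IsTailFreePath n a b P)
    (Y : seaweed n a b) :
    phiOne n a b P.supp ⁅(⟨_, hOne_mem ha P.supp⟩ : seaweed n a b), Y⁆ = 0 := by
  have hf := (isGraded_vertexIndicator ha hb P).full ha hb
    (fun i hi h => by rw [hP.indicator_tail i hi (D.inTail hi (Or.inl h)), neg_zero, add_zero])
    (fun i hi h => by rw [hP.indicator_tail i hi (D.inTail hi (Or.inr h)), neg_zero, add_zero])
  set h : ℕ → ℂ := fun i => if i < n then vertexIndicator P.supp i else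
    -vertexIndicator P.supp (2 * n - 1 - i) with hh
  have hd : (⟨_, hOne_mem ha P.supp⟩ : seaweed n a b).1 = Matrix.diagonal fun p : Fin (2 * n) => h p := by
    ext p q
    exact (hOne_apply P.supp p q).trans (Matrix.diagonal_apply (fun p : Fin (2 * n) => h p) p q).symm
  rw [phiOne_apply]
  refine Finset.sum_eq_zero fun p _ => Finset.sum_eq_zero fun q _ => ?_
  rw [LieSubalgebra.coe_bracket, Ring.lie_def, Matrix.sub_apply, hd, Matrix.diagonal_mul,
    Matrix.mul_diagonal]
  by_cases hpq : p = q
  · subst hpq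
    ring
  · by_cases hE : OrientedFullEdge n a b p q
    · have := hf p q hE
      rw [add_zero] at this
      rw [this]
      ring
    · rw [phiCoeff, if_neg hpq, if_neg fun h => hE h.1, add_zero, zero_mul]

theorem eq_smul_hOne {i₀ : ℕ} (D : MeanderData n a b [i₀]) (ha : a.sum ≤ n)
    (hb : b.sum ≤ n) {P : (meander n a b).ConnectedComponent} (hP : IsTailFreePath n a b P)
    {X : seaweed n a b} (hX : ∀ Y : seaweed n a b, phiOne n a b P.supp ⁅X, Y⁆ = 0) :
    (X : Matrix (Fin (2 * n)) (Fin (2 * n)) ℂ) = extendZero X.1 i₀ i₀ • hOne n P.supp := by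
  obtain ⟨M, hM⟩ : ∃ M : Matrix (Fin (2 * n)) (Fin (2 * n)) ℂ, M = X.1 := ⟨_, rfl⟩
  have K := kernelData_extendZero ha hb P.supp (D.grading_full ha hb) hX
  obtain ⟨diag, const⟩ := K.isDiagonalAlong
  have hi₀ : i₀ < n := (D.point i₀ (by simp)).1
  have const' : ∀ i j, DirectedArc (fullComposition n a) (fullComposition n b) i j →
      extendZero M i i = extendZero M j j := by
    intro i j h
    have hij : i ≠ j := h.elim (fun h => h.2.ne) fun h => h.2.ne
    rw [hM]
    exact const i j hij ((K.spec i j hij).2 h)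
  rw [← hM] at diag ⊢
  have hsp : M ∈ sp n := hM ▸ (mem_seaweed.1 X.2).1
  have odd : ∀ i < n, extendZero M i i = -extendZero M (2 * n - 1 - i) (2 * n - 1 - i) := by
    intro i hi
    have h := mem_sp'.1 hsp ⟨i, by omega⟩ ⟨i, by omega⟩
    rw [neg_mul, indexSign_mul_self, neg_one_mul, ← extendZero_val M, ← extendZero_val M,
      Fin.val_rev] at h
    rwa [show 2 * n - 1 - i = 2 * n - (i + 1) by omega]
  have graded : IsGraded 0 a b fun i => extendZero M i i := by
    intro i j h
    rw [add_zero]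
    refine (const' i j ?_).symm
    exact h.imp (fun h => ⟨h.1, h.2.full⟩) fun h => ⟨h.1, h.2.full⟩
  have tail : ∀ i < n, InTail a b i → extendZero M i i = 0 := by
    intro i hi ht
    -- A tail vertex lies in exactly one middle block, whose arc joins it to its reflection;
    -- together with oddness this gives zero.
    have h : extendZero M i i = extendZero M (2 * n - 1 - i) (2 * n - 1 - i) := by
      rcases ht with ht | ht
      · exact (const' _ _ (Or.inl ⟨by omega, (arc_full_mid ht.1 hi).symm⟩)).symm
      · exact const' _ _ (Or.inr ⟨by omega, arc_full_mid ht.1 hi⟩)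
    have h' := odd i hi
    rw [← h] at h'
    exact self_eq_neg.1 h'
  have main : ∀ i < n, extendZero M i i = extendZero M i₀ i₀ * vertexIndicator P.supp i := by
    intro i hi
    -- The difference of both sides is constant along arcs and vanishes on the tail and at i₀.
    refine sub_eq_zero.1 (D.determined
      (fun i => extendZero M i i - extendZero M i₀ i₀ * vertexIndicator P.supp i)
      (fun i j h => ?_) (fun j hj ht => ?_) (fun j hj => ?_) i hi)
    · simp only [graded i j h, isGraded_vertexIndicator ha hb P i j h, add_zero]
    · simp only [tail j hj ht, hP.indicator_tail j hj ht, mul_zero, sub_zero]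
    · obtain rfl := List.mem_singleton.1 hj
      have := vertexIndicator_of_mem (hP.mem_supp D ha hb hi₀)
      simp only at this
      simp only [this, mul_one, sub_self]
  ext p q
  rw [Matrix.smul_apply, hOne_apply, ← extendZero_val M p q, smul_eq_mul]
  by_cases hpq : p = q
  · subst hpq
    have hp := p.2
    rw [if_pos rfl]
    split_ifs with h
    · exact main p h
    · have h₁ := odd (2 * n - 1 - p) (by omega)
      rw [show 2 * n - 1 - (2 * n - 1 - (p : ℕ)) = p by omega] at h₁
      rw [← neg_eq_iff_eq_neg.2 h₁, main _ (by omega), mul_neg]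
  · rw [if_neg hpq, mul_zero]
    exact diag p q fun h => hpq (Fin.ext h)

end SeaweedC

theorem theorem3p7 (n : ℕ) (a b : List ℕ)
    (ha : SeaweedC.IsPartialComposition n a) (hb : SeaweedC.IsPartialComposition n b)
    (hH : ∃ s : ℕ, SeaweedC.HasHomotopyType n a b [1] (List.replicate s 1) 0) :
    (∃! P : (SeaweedC.meander n a b).ConnectedComponent, SeaweedC.IsTailFreePath n a b P) ∧
    ∀ P : (SeaweedC.meander n a b).ConnectedComponent, SeaweedC.IsTailFreePath n a b P →
      Submodule.map (SeaweedC.seaweed n a b).toSubmodule.subtype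
          (LinearMap.ker (SeaweedC.kirillovForm (SeaweedC.phiOne n a b P.supp))) =
        Submodule.span ℂ {SeaweedC.hOne n P.supp} := by
  obtain ⟨s, k, w, hk⟩ := hH
  -- The truncated difference k - s is zero, which says that no vertex lies beyond the tail blocks.
  have hk' : k ≤ s := by
    simp only [List.sum_replicate, smul_eq_mul, mul_one] at hk
    omega
  obtain ⟨I, hI, D⟩ := w.meanderData rfl hk' (by simp) ha.2 hb.2
  obtain ⟨i₀, rfl⟩ := List.length_eq_one_iff.1 hI
  refine ⟨D.existsUnique_isTailFreePath ha.2 hb.2, fun P hP => le_antisymm ?_ ?_⟩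
  · rintro _ ⟨X, hX, rfl⟩
    refine Submodule.mem_span_singleton.2
      ⟨_, (SeaweedC.eq_smul_hOne D ha.2 hb.2 hP (X := X) fun Y => ?_).symm⟩
    exact LinearMap.congr_fun (LinearMap.mem_ker.1 hX) Y
  · rw [Submodule.span_singleton_le_iff_mem]
    refine ⟨⟨_, SeaweedC.hOne_mem ha.2 P.supp⟩, LinearMap.mem_ker.2 ?_, rfl⟩
    exact LinearMap.ext fun Y => SeaweedC.phiOne_hOne_bracket D ha.2 hb.2 hP Y
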